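/- Let $D\ge 1$ and embed $\mathbb N^D$ in $\mathbb R^D$. Let $\Lambda\subset\mathbb N^D$ be a finite set of sites, each carrying a finite-dimensional Hilbert space, and for $i,j\in\Lambda$ and times $s$ let $h_{i,j}(s)$ be a Hermitian operator on the tensor product of these spaces, supported on the sites $i,j$ and locally integrable in $s$. The interactions are power-law decaying with exponent $\alpha$ if $\|h_{i,j}(s)\|\le \|i-j\|^{-\alpha}$ for all $i\ne j$ and all $s$ (the on-site terms $h_{i,i}$ may have arbitrarily large norm), where $\|\cdot\|$ is the Euclidean norm for vectors and the operator norm for operators. For $X\subset\mathbb R^D$ put $H_X(s)=\sum_{i,j\in X\cap\Lambda}h_{i,j}(s)$ and $U^X_{0,t}=\mathcal T\exp\bigl(-i\int_0^t H_X(s)\,ds\bigr)$, with $\mathcal T$ the time ordering; write $XY=X\cup Y$, let $\operatorname{dist}(X,Y)$ be the minimum distance between a site of $X\cap\Lambda$ and a site of $Y\cap\Lambda$, and let $\Phi(X)$ be the surface area ($(D-1)$-dimensional Hausdorff measure) of $\partial X$. There is a constant $v>0$ depending only on $D$, and for all $\delta>0$ and $\rho>0$ there is a constant $c_0>0$ depending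 only on $D,\delta,\rho$, such that the following holds for every $\gamma\in(0,1)$ and every $\alpha\ge D+1+\delta$. Let the interactions be power-law decaying with exponent $\alpha$. Let $A,B,C\subset\mathbb R^D$ have non-empty interiors, with $A\cup B\cup C=\mathbb R^D$ and $A\cap C=\emptyset$; let $A$ be compact and convex and, if $D\ge2$, contain a closed ball of radius $\rho$. Then for every $t\ge0$, with $\ell=\operatorname{dist}(A,C)$, $$\Bigl\|U^{ABC}_{0,t}-U^{AB}_{0,t}\bigl(U^{B}_{0,t}\bigr)^\dagger U^{BC}_{0,t}\Bigr\|\le c_0\,(e^{vt}-1)\,\Phi(A)\,\xi_\alpha(\ell),\qquad \xi_\alpha(\ell)=\Bigl(\frac{16}{1-\gamma}\Bigr)^{\alpha}\frac1{\ell^{\alpha-D-1}}+e^{-\gamma\ell}.$$ (If $A$ or $C$ contains no site, the left-hand side is $0$.) -/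

import Mathlib

open MeasureTheory
open scoped Matrix Matrix.Norms.L2Operator

namespace PowerLaw

noncomputable section

/-- A point of `ℕ^D`, viewed in Euclidean space `ℝ^D`. -/
def embed {D : ℕ} (i : Fin D → ℕ) : EuclideanSpace ℝ (Fin D) :=
  WithLp.toLp 2 (fun k => (i k : ℝ))

/-- The label set of the product basis of the many-body Hilbert space `⨂ i, ℂ^(q i)`
of the sites `i ∈ Λ`, where site `i` has local dimension `q i`. -/
abbrev Config {D : ℕ} (Λ : Finset (Fin D → ℕ)) (q : Λ → ℕ) : Type :=
  (i : Λ) → Fin (q i)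

/-- Operators on the many-body Hilbert space, as matrices in the product basis. The norm `‖M‖`
is the operator norm of the Euclidean (2-)norm. -/
abbrev Op {D : ℕ} (Λ : Finset (Fin D → ℕ)) (q : Λ → ℕ) : Type :=
  Matrix (Config Λ q) (Config Λ q) ℂ

open scoped Classical in
/-- `M` is supported on the set of sites `S`: it has the form `N ⊗ 1`, where `N` acts on the
sites in `S` and `1` is the identity on the remaining sites. -/
def SupportedOn {D : ℕ} {Λ : Finset (Fin D → ℕ)} {q : Λ → ℕ} (S : Set Λ) (M : Op Λ q) : Prop :=
  ∃ N : Matrix ((i : S) → Fin (q i)) ((i : S) → Fin (q i)) ℂ,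
    ∀ x y : Config Λ q,
      M x y = if ∀ i, i ∉ S → x i = y i then N (fun i => x i) (fun i => y i) else 0

/-- A family `h i j s` of (time-dependent) interaction terms is power-law decaying with exponent
`α`: each `h i j s` is a Hermitian operator supported on the sites `i` and `j`, locally integrable
in the time `s`, and `‖h i j s‖ ≤ 1 / ‖i - j‖ ^ α` for `i ≠ j`. There is no bound on the on-site
terms `h i i s`. -/
structure IsPowerLawInteraction {D : ℕ} (Λ : Finset (Fin D → ℕ)) (q : Λ → ℕ) (α : ℝ)
    (h : Λ → Λ → ℝ → Op Λ q) : Prop where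
  hermitian : ∀ i j s, (h i j s).IsHermitian
  supported : ∀ i j s, SupportedOn {i, j} (h i j s)
  integrable : ∀ i j a b, IntervalIntegrable (h i j) volume a b
  decay : ∀ i j s, i ≠ j →
    ‖h i j s‖ ≤ 1 / dist (embed (i : Fin D → ℕ)) (embed (j : Fin D → ℕ)) ^ α

open scoped Classical in
/-- `H_X(s)`: the sum of the terms `h i j s` over all sites `i, j ∈ Λ ∩ X`. -/
def hamiltonian {D : ℕ} {Λ : Finset (Fin D → ℕ)} {q : Λ → ℕ} (h : Λ → Λ → ℝ → Op Λ q)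
    (X : Set (EuclideanSpace ℝ (Fin D))) (s : ℝ) : Op Λ q :=
  ∑ i : Λ, ∑ j : Λ,
    if embed (i : Fin D → ℕ) ∈ X ∧ embed (j : Fin D → ℕ) ∈ X then h i j s else 0

/-- The `k`-th term of the Dyson series,
`(-i)^k ∫_{a ≤ s₁ ≤ ⋯ ≤ s_k ≤ t} H(s_k) ⋯ H(s₁) ds₁ ⋯ ds_k`. -/
def dysonTerm {n : Type*} [Fintype n] [DecidableEq n] (H : ℝ → Matrix n n ℂ) (a : ℝ) :
    ℕ → ℝ → Matrix n n ℂ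
  | 0, _ => 1
  | k + 1, t => ∫ s in a..t, (-Complex.I) • (H s * dysonTerm H a k s)

/-- The time-ordered exponential `𝒯 exp(-i ∫_a^b H(s) ds)`, later times to the left. -/
def timeOrderedExp {n : Type*} [Fintype n] [DecidableEq n] (H : ℝ → Matrix n n ℂ) (a b : ℝ) :
    Matrix n n ℂ :=
  ∑' k : ℕ, dysonTerm H a k b

/-- `U^X_{a,b}`: the evolution from time `a` to time `b` under `H_X`. -/
def evolution {D : ℕ} {Λ : Finset (Fin D → ℕ)} {q : Λ → ℕ} (h : Λ → Λ → ℝ → Op Λ q)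
    (X : Set (EuclideanSpace ℝ (Fin D))) (a b : ℝ) : Op Λ q :=
  timeOrderedExp (hamiltonian h X) a b

/-- The minimum distance between a site of `Λ` in `X` and a site of `Λ` in `Y`
(`0`, by convention, if `X` or `Y` contains no site). -/
def siteDist {D : ℕ} (Λ : Finset (Fin D → ℕ)) (X Y : Set (EuclideanSpace ℝ (Fin D))) : ℝ :=
  sInf {r | ∃ i ∈ Λ, ∃ j ∈ Λ, embed i ∈ X ∧ embed j ∈ Y ∧ r = dist (embed i) (embed j)}

/-- `Φ(X)`: the area of the boundary of `X`, that is, its `(D-1)`-dimensional Hausdorff measure,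
normalised so as to agree with Lebesgue measure on `ℝ^(D-1)`. It is used for `D ≥ 1`. -/
def boundaryArea {D : ℕ} (X : Set (EuclideanSpace ℝ (Fin D))) : ℝ :=
  (Measure.euclideanHausdorffMeasure (D - 1) (frontier X)).toReal

/-- `ξ_α(ℓ) = (16 / (1 - γ))^α / ℓ^(α - D - 1) + e^(-γ ℓ)`. -/
def xi (D : ℕ) (γ α ℓ : ℝ) : ℝ :=
  (16 / (1 - γ)) ^ α * (1 / ℓ ^ (α - D - 1)) + Real.exp (-(γ * ℓ))

end

end PowerLaw

/-! Let `a`, `b`, `c` be the sites of A∖B, B, C∖B, and let R = U^{AB}(U^B)†. Differentiating U^{ABC}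
- R U^{BC} and removing the unitary factors bounds the error by the time integral of ‖[K,R]‖ + ‖V‖,
where K collects the interactions joining `b` to `c` and V those joining `a` to `c`
(`norm_evolution_sub_le`). Terms inside `c` commute with R and drop out.

The commutator of R with an operator on one or two sites obeys a Lieb–Robinson bound
(`IsLocalSystem.norm_commutator_le`): it is controlled by an exponential series of a kernel w
applied to the indicator of `a`, with w(x,z) = max(1,|x-z|)^{-α} on the lattice. The terms internal
to the support of the operator are absorbed by letting the operator itself evolve
(`IsEvolution.norm_commutator_le`), so on-site norms never enter. The error thus becomes the sum
over m of (const·t)^m/m! times the total weight of m-hop paths between `c` and `a`.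

Fix the hops v_1,…,v_m. The possible endpoints inject into the lattice points that leave A under
translation by the sum of the hops. This exit count is subadditive in the translation, and under a
unit step convexity allows one exit per lattice line, so it is at most the number of lattice points
in a coordinate shadow of A. The volume of the shadow is at most Φ(A), hence the exit count is at
most const·Φ(A)·∑|v_i| (`exists_exitCount_le`). Getting the area costs one power of length, which is
why the final exponent is α-D-1.

It remains to sum (∑|v_i|)∏|v_i|^{-α} over hops with ∑|v_i| ≥ ℓ (`sum_paths_of_le_sum_le`). Either m
≥ γℓ/2, and e^{2m-γℓ} ≥ 1 pays for the path; or the hops of length at least 2 add up to more than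
(1-γ)ℓ, so the product of all lengths is that large too, and a one-hop tail estimate gives
((1-γ)ℓ)^{-(α-D-1)}. Each further hop costs only a constant factor, so the series sums to e^{vt}-1;
the term m = 0 vanishes because `a` and `c` are disjoint. -/

namespace PowerLaw

/-! ### Calculus for primitives of locally integrable functions. -/

section Primitive

open Set

/-- `F` is, on `[0, ∞)`, a primitive of the locally integrable function `f`. -/
structure IsPrimitive {E : Type*} [NormedAddCommGroup E] [NormedSpace ℝ E] (F f : ℝ → E) :
    Prop where
  integrable : ∀ t, 0 ≤ t → IntervalIntegrable f volume 0 t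
  eq : ∀ t, 0 ≤ t → F t = F 0 + ∫ s in (0 : ℝ)..t, f s

/-- Integration by parts without continuity: by Fubini the two terms are the integrals of f(s)g(u)
over the triangles u ≤ s and s < u, which together fill the square. The order of the factors is
kept, since the algebra is noncommutative. -/
theorem integral_mul_primitive_add {A : Type*} [NormedRing A] [NormedAlgebra ℝ A]
    [CompleteSpace A] {f g : ℝ → A} {t : ℝ} (ht : 0 ≤ t)
    (hf : IntervalIntegrable f volume 0 t) (hg : IntervalIntegrable g volume 0 t) :
    (∫ s in (0 : ℝ)..t, f s * ∫ u in (0 : ℝ)..s, g u) +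
      ∫ s in (0 : ℝ)..t, (∫ u in (0 : ℝ)..s, f u) * g s =
      (∫ s in (0 : ℝ)..t, f s) * ∫ s in (0 : ℝ)..t, g s := by
  rw [intervalIntegrable_iff_integrableOn_Ioc_of_le ht] at hf hg
  have hprod : Integrable (fun z : ℝ × ℝ => f z.1 * g z.2)
      ((volume.restrict (Ioc 0 t)).prod (volume.restrict (Ioc 0 t))) := hf.mul_prod hg
  have hm : MeasurableSet {z : ℝ × ℝ | z.2 ≤ z.1} := measurableSet_le measurable_snd measurable_fst
  have hlow := hprod.indicator hm
  have hupp := hprod.indicator hm.compl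
  have h1 : ∫ s in (0 : ℝ)..t, f s * ∫ u in (0 : ℝ)..s, g u =
      ∫ s in Ioc 0 t, ∫ u in Ioc 0 t,
        {z : ℝ × ℝ | z.2 ≤ z.1}.indicator (fun z : ℝ × ℝ => f z.1 * g z.2) (s, u) := by
    rw [intervalIntegral.integral_of_le ht]
    refine setIntegral_congr_fun measurableSet_Ioc fun s hs => ?_
    have : (fun u => {z : ℝ × ℝ | z.2 ≤ z.1}.indicator (fun z : ℝ × ℝ => f z.1 * g z.2) (s, u)) =
        (Iic s).indicator (fun u => f s * g u) := by
      ext u; simp [indicator]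
    simp only [this]
    rw [setIntegral_indicator measurableSet_Iic,
      show Ioc 0 t ∩ Iic s = Ioc 0 s from by
        ext u; simp only [mem_inter_iff, mem_Ioc, mem_Iic]
        exact ⟨fun h => ⟨h.1.1, h.2⟩, fun h => ⟨⟨h.1, h.2.trans hs.2⟩, h.2⟩⟩,
      intervalIntegral.integral_of_le hs.1.le]
    exact (integral_const_mul_of_integrable
      (hg.mono_set (Ioc_subset_Ioc_right hs.2) : IntegrableOn g (Ioc 0 s))).symm
  have h2 : ∫ s in (0 : ℝ)..t, (∫ u in (0 : ℝ)..s, f u) * g s =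
      ∫ s in Ioc 0 t, ∫ u in Ioc 0 t,
        {z : ℝ × ℝ | z.2 ≤ z.1}ᶜ.indicator (fun z : ℝ × ℝ => f z.1 * g z.2) (s, u) := by
    rw [integral_integral_swap (f := fun s u =>
        {z : ℝ × ℝ | z.2 ≤ z.1}ᶜ.indicator (fun z : ℝ × ℝ => f z.1 * g z.2) (s, u)) hupp,
      intervalIntegral.integral_of_le ht]
    refine setIntegral_congr_fun measurableSet_Ioc fun u hu => ?_
    have : (fun s => {z : ℝ × ℝ | z.2 ≤ z.1}ᶜ.indicator (fun z : ℝ × ℝ => f z.1 * g z.2) (s, u)) =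
        (Iio u).indicator (fun s => f s * g u) := by
      ext s; simp [indicator]
    simp only [this]
    rw [setIntegral_indicator measurableSet_Iio,
      show Ioc 0 t ∩ Iio u = Ioo 0 u from by
        ext s; simp only [mem_inter_iff, mem_Ioc, mem_Iio, mem_Ioo]
        exact ⟨fun h => ⟨h.1.1, h.2⟩, fun h => ⟨⟨h.1, h.2.le.trans hu.2⟩, h.2⟩⟩,
      ← integral_Ioc_eq_integral_Ioo, intervalIntegral.integral_of_le hu.1.le]
    exact (integral_mul_const_of_integrable
      (hf.mono_set (Ioc_subset_Ioc_right hu.2) : IntegrableOn f (Ioc 0 u))).symm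
  rw [h1, h2, ← integral_add hlow.integral_prod_left hupp.integral_prod_left,
    intervalIntegral.integral_of_le ht, intervalIntegral.integral_of_le ht]
  have h3 : ∀ᵐ s ∂(volume.restrict (Ioc 0 t)),
      (∫ u in Ioc 0 t, {z : ℝ × ℝ | z.2 ≤ z.1}.indicator (fun z : ℝ × ℝ => f z.1 * g z.2) (s, u)) +
        ∫ u in Ioc 0 t,
          {z : ℝ × ℝ | z.2 ≤ z.1}ᶜ.indicator (fun z : ℝ × ℝ => f z.1 * g z.2) (s, u) =
      f s * ∫ u in Ioc 0 t, g u := by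
    filter_upwards [hlow.prod_right_ae, hupp.prod_right_ae] with s hs1 hs2
    rw [← integral_add hs1 hs2, ← integral_const_mul_of_integrable hg]
    congr 1
    ext u
    exact congrFun (indicator_self_add_compl _ _) (s, u)
  rw [integral_congr_ae h3, integral_mul_const_of_integrable hf]

namespace IsPrimitive

variable {E : Type*} [NormedAddCommGroup E] [NormedSpace ℝ E] {F G f g : ℝ → E}

theorem continuousOn (hF : IsPrimitive F f) {t : ℝ} (ht : 0 ≤ t) : ContinuousOn F (uIcc 0 t) := by
  have h1 : ContinuousOn (fun s => F 0 + ∫ u in (0 : ℝ)..s, f u) (uIcc 0 t) :=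
    continuousOn_const.add (intervalIntegral.continuousOn_primitive_interval
      (((intervalIntegrable_iff' enorm_ne_top).1 (hF.integrable t ht))))
  refine h1.congr fun s hs => hF.eq s ?_
  rw [uIcc_of_le ht] at hs
  exact hs.1

theorem const (c : E) : IsPrimitive (fun _ => c) (fun _ => 0) :=
  ⟨fun _ _ => intervalIntegrable_const, fun _ _ => by simp⟩

theorem add (hF : IsPrimitive F f) (hG : IsPrimitive G g) :
    IsPrimitive (fun s => F s + G s) (fun s => f s + g s) where
  integrable t ht := (hF.integrable t ht).add (hG.integrable t ht)
  eq t ht := by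
    rw [intervalIntegral.integral_add (hF.integrable t ht) (hG.integrable t ht), hF.eq t ht,
      hG.eq t ht]
    abel

theorem sub (hF : IsPrimitive F f) (hG : IsPrimitive G g) :
    IsPrimitive (fun s => F s - G s) (fun s => f s - g s) where
  integrable t ht := (hF.integrable t ht).sub (hG.integrable t ht)
  eq t ht := by
    rw [intervalIntegral.integral_sub (hF.integrable t ht) (hG.integrable t ht), hF.eq t ht,
      hG.eq t ht]
    abel

theorem congr (hF : IsPrimitive F f) (h : ∀ s, 0 ≤ s → f s = g s) : IsPrimitive F g where
  integrable t ht := (hF.integrable t ht).congr fun s hs => h s (by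
    rw [uIoc_of_le ht] at hs; exact hs.1.le)
  eq t ht := by
    rw [hF.eq t ht]
    congr 1
    refine intervalIntegral.integral_congr fun s hs => h s ?_
    rw [uIcc_of_le ht] at hs
    exact hs.1

theorem clm {E' : Type*} [NormedAddCommGroup E'] [NormedSpace ℝ E'] [CompleteSpace E]
    [CompleteSpace E'] (hF : IsPrimitive F f) (L : E →L[ℝ] E') :
    IsPrimitive (fun s => L (F s)) (fun s => L (f s)) where
  integrable t ht := by
    have := hF.integrable t ht
    rw [intervalIntegrable_iff] at this ⊢
    exact L.integrable_comp this
  eq t ht := by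
    rw [L.intervalIntegral_comp_comm (hF.integrable t ht), hF.eq t ht, map_add]

theorem mul {A : Type*} [NormedRing A] [NormedAlgebra ℝ A] [CompleteSpace A] {F G f g : ℝ → A}
    (hF : IsPrimitive F f) (hG : IsPrimitive G g) :
    IsPrimitive (fun s => F s * G s) (fun s => f s * G s + F s * g s) where
  integrable t ht := ((hF.integrable t ht).mul_continuousOn (hG.continuousOn ht)).add
    ((hG.integrable t ht).continuousOn_mul (hF.continuousOn ht))
  eq t ht := by
    have hf := hF.integrable t ht
    have hg := hG.integrable t ht
    have e1 : ∫ s in (0 : ℝ)..t, f s * G s =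
        (∫ s in (0 : ℝ)..t, f s * G 0) + ∫ s in (0 : ℝ)..t, f s * ∫ u in (0 : ℝ)..s, g u := by
      rw [← intervalIntegral.integral_add (hf.mul_continuousOn continuousOn_const)
        (hf.mul_continuousOn (intervalIntegral.continuousOn_primitive_interval
          ((intervalIntegrable_iff' enorm_ne_top).1 hg)))]
      refine intervalIntegral.integral_congr fun s hs => ?_
      rw [uIcc_of_le ht] at hs
      simp only [hG.eq s hs.1, mul_add]
    have e2 : ∫ s in (0 : ℝ)..t, F s * g s =
        (∫ s in (0 : ℝ)..t, F 0 * g s) + ∫ s in (0 : ℝ)..t, (∫ u in (0 : ℝ)..s, f u) * g s := by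
      rw [← intervalIntegral.integral_add (hg.continuousOn_mul continuousOn_const)
        (hg.continuousOn_mul (intervalIntegral.continuousOn_primitive_interval
          ((intervalIntegrable_iff' enorm_ne_top).1 hf)))]
      refine intervalIntegral.integral_congr fun s hs => ?_
      rw [uIcc_of_le ht] at hs
      simp only [hF.eq s hs.1, add_mul]
    have e3 : ∫ s in (0 : ℝ)..t, f s * G 0 = (∫ s in (0 : ℝ)..t, f s) * G 0 := by
      rw [intervalIntegral.integral_of_le ht, intervalIntegral.integral_of_le ht]
      rw [intervalIntegrable_iff_integrableOn_Ioc_of_le ht] at hf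
      exact integral_mul_const_of_integrable hf
    have e4 : ∫ s in (0 : ℝ)..t, F 0 * g s = F 0 * ∫ s in (0 : ℝ)..t, g s := by
      rw [intervalIntegral.integral_of_le ht, intervalIntegral.integral_of_le ht]
      rw [intervalIntegrable_iff_integrableOn_Ioc_of_le ht] at hg
      exact integral_const_mul_of_integrable hg
    rw [intervalIntegral.integral_add (hf.mul_continuousOn (hG.continuousOn ht))
      (hg.continuousOn_mul (hF.continuousOn ht)), e1, e2, e3, e4, hF.eq t ht, hG.eq t ht]
    have e5 := integral_mul_primitive_add ht hf hg
    rw [add_mul, mul_add, mul_add, ← e5]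
    abel

theorem star {A : Type*} [CStarAlgebra A] {F f : ℝ → A} (hF : IsPrimitive F f) :
    IsPrimitive (fun s => star (F s)) (fun s => star (f s)) :=
  hF.clm ((starL' ℝ : A ≃L[ℝ] A) : A →L[ℝ] A)

theorem norm_le (hF : IsPrimitive F f) {t : ℝ} (ht : 0 ≤ t) :
    ‖F t‖ ≤ ‖F 0‖ + ∫ s in (0 : ℝ)..t, ‖f s‖ := by
  rw [hF.eq t ht]
  exact (norm_add_le _ _).trans
    (add_le_add_right (intervalIntegral.norm_integral_le_integral_norm ht) _)

end IsPrimitive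

end Primitive

/-! ### The Dyson series solves the Schrödinger equation in integral form. -/

section Dyson

open Set

variable {n : Type*} [Fintype n] [DecidableEq n] {H : ℝ → Matrix n n ℂ}

theorem IsPrimitive.pow_succ_div_factorial {m f : ℝ → ℝ} (hm : IsPrimitive m f)
    (k : ℕ) : IsPrimitive (fun s => m s ^ (k + 1) / (k + 1).factorial)
      (fun s => f s * (m s ^ k / k.factorial)) := by
  have hp : ∀ k : ℕ, IsPrimitive (fun s => m s ^ (k + 1)) (fun s => (k + 1) * (f s * m s ^ k)) := by
    intro k
    induction k with
    | zero => simpa using hm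
    | succ k ih =>
      refine (funext fun s => (pow_succ (m s) (k + 1)).symm) ▸ (ih.mul hm).congr fun s _ => ?_
      push_cast
      ring
  have h := ((hp k).clm (ContinuousLinearMap.mul ℝ ℝ (((k + 1).factorial : ℝ)⁻¹))).congr
    (g := fun s => f s * (m s ^ k / k.factorial)) fun s _ => ?_
  · simpa [div_eq_inv_mul] using h
  · rw [Nat.factorial_succ]
    have h1 : (k.factorial : ℝ) ≠ 0 := by positivity
    have h2 : (k : ℝ) + 1 ≠ 0 := by positivity
    simp only [ContinuousLinearMap.mul_apply', Nat.cast_mul, Nat.cast_add, Nat.cast_one]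
    field_simp

theorem dysonTerm_isPrimitive (hH : ∀ t, IntervalIntegrable H volume 0 t) (k : ℕ) :
    (∀ t, 0 ≤ t → ContinuousOn (dysonTerm H 0 k) (uIcc 0 t)) ∧
      IsPrimitive (dysonTerm H 0 (k + 1)) (fun s => (-Complex.I) • (H s * dysonTerm H 0 k s)) := by
  have aux : ∀ k, (∀ t, 0 ≤ t → ContinuousOn (dysonTerm H 0 k) (uIcc 0 t)) →
      IsPrimitive (dysonTerm H 0 (k + 1)) (fun s => (-Complex.I) • (H s * dysonTerm H 0 k s)) :=
    fun k hk => ⟨fun t ht => ((hH t).mul_continuousOn (hk t ht)).smul (-Complex.I),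
      fun t _ => by simp [dysonTerm]⟩
  induction k with
  | zero => exact ⟨fun t _ => continuousOn_const, aux 0 fun t _ => continuousOn_const⟩
  | succ k ih =>
    exact ⟨fun t ht => ih.2.continuousOn ht, aux (k + 1) fun t ht => ih.2.continuousOn ht⟩

theorem isPrimitive_integral_norm (hH : ∀ t, IntervalIntegrable H volume 0 t) :
    IsPrimitive (fun t => ∫ s in (0 : ℝ)..t, ‖H s‖) (fun s => ‖H s‖) :=
  ⟨fun t _ => (hH t).norm, fun t _ => by simp⟩

/-- The ordered simplex contributes the factor 1/k!, seen here by integrating the bound for k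
against ‖H‖; this makes the series converge for any integrable H. -/
theorem norm_dysonTerm_le (hH : ∀ t, IntervalIntegrable H volume 0 t) (k : ℕ) :
    ∀ t, 0 ≤ t → ‖dysonTerm H 0 k t‖ ≤
      ‖(1 : Matrix n n ℂ)‖ * ((∫ s in (0 : ℝ)..t, ‖H s‖) ^ k / k.factorial) := by
  induction k with
  | zero => intro t _; simp [dysonTerm]
  | succ k ih =>
    intro t ht
    have hp := (isPrimitive_integral_norm hH).pow_succ_div_factorial k
    have hq := (dysonTerm_isPrimitive hH k).2
    have h1 := hq.norm_le ht
    have h0 : dysonTerm H 0 (k + 1) 0 = 0 := by simp [dysonTerm]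
    rw [h0, norm_zero, zero_add] at h1
    refine h1.trans ?_
    rw [hp.eq t ht]
    simp only [intervalIntegral.integral_same, ne_eq, Nat.add_eq_zero_iff, one_ne_zero, and_false,
      not_false_eq_true, zero_pow, zero_div, zero_add]
    rw [← intervalIntegral.integral_const_mul]
    refine intervalIntegral.integral_mono_on ht (hq.integrable t ht).norm
      ((hp.integrable t ht).const_mul _) fun s hs => ?_
    rw [norm_smul, norm_neg, Complex.norm_I, one_mul]
    calc ‖H s * dysonTerm H 0 k s‖ ≤ ‖H s‖ * ‖dysonTerm H 0 k s‖ := norm_mul_le _ _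
      _ ≤ ‖H s‖ * (‖(1 : Matrix n n ℂ)‖ * ((∫ s in (0 : ℝ)..s, ‖H s‖) ^ k / k.factorial)) := by
        gcongr; exact ih s hs.1
      _ = _ := by ring

theorem norm_dysonTerm_le_of_le (hH : ∀ t, IntervalIntegrable H volume 0 t) (k : ℕ) {s t : ℝ}
    (hs : 0 ≤ s) (hst : s ≤ t) : ‖dysonTerm H 0 k s‖ ≤
      ‖(1 : Matrix n n ℂ)‖ * ((∫ s in (0 : ℝ)..t, ‖H s‖) ^ k / k.factorial) := by
  refine (norm_dysonTerm_le hH k s hs).trans ?_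
  have h0 : 0 ≤ ∫ s in (0 : ℝ)..s, ‖H s‖ :=
    intervalIntegral.integral_nonneg hs fun _ _ => norm_nonneg _
  gcongr
  rw [← intervalIntegral.integral_add_adjacent_intervals (hH s).norm
    ((hH s).norm.symm.trans (hH t).norm)]
  exact le_add_of_nonneg_right (intervalIntegral.integral_nonneg hst fun _ _ => norm_nonneg _)

theorem hasSum_dysonTerm (hH : ∀ t, IntervalIntegrable H volume 0 t) {t : ℝ} (ht : 0 ≤ t) :
    HasSum (fun k => dysonTerm H 0 k t) (timeOrderedExp H 0 t) :=
  (Summable.of_norm_bounded ((Real.summable_pow_div_factorial _).mul_left _)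
    fun k => norm_dysonTerm_le hH k t ht).hasSum

theorem timeOrderedExp_continuousOn (hH : ∀ t, IntervalIntegrable H volume 0 t) {t : ℝ}
    (ht : 0 ≤ t) : ContinuousOn (timeOrderedExp H 0) (uIcc 0 t) :=
  continuousOn_tsum (fun k => (dysonTerm_isPrimitive hH k).1 t ht)
    ((Real.summable_pow_div_factorial (∫ s in (0 : ℝ)..t, ‖H s‖)).mul_left ‖(1 : Matrix n n ℂ)‖)
    fun k s hs => by
      rw [uIcc_of_le ht] at hs
      exact norm_dysonTerm_le_of_le hH k hs.1 hs.2

theorem timeOrderedExp_zero : timeOrderedExp H 0 0 = 1 := by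
  rw [timeOrderedExp, tsum_eq_single 0]
  · rfl
  · intro k hk
    obtain ⟨k, rfl⟩ := Nat.exists_eq_succ_of_ne_zero hk
    simp [dysonTerm]

theorem timeOrderedExp_isPrimitive (hH : ∀ t, IntervalIntegrable H volume 0 t) :
    IsPrimitive (timeOrderedExp H 0) (fun s => (-Complex.I) • (H s * timeOrderedExp H 0 s)) where
  integrable t ht := ((hH t).mul_continuousOn (timeOrderedExp_continuousOn hH ht)).smul (-Complex.I)
  eq t ht := by
    have h1 := hasSum_dysonTerm hH ht
    have hsum := (Real.summable_pow_div_factorial (∫ s in (0 : ℝ)..t, ‖H s‖)).mul_left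
      ‖(1 : Matrix n n ℂ)‖
    have h2 : HasSum (fun k => dysonTerm H 0 (k + 1) t)
        (∫ s in (0 : ℝ)..t, (-Complex.I) • (H s * timeOrderedExp H 0 s)) := by
      refine intervalIntegral.hasSum_integral_of_dominated_convergence
        (fun k s => ‖H s‖ * (‖(1 : Matrix n n ℂ)‖ *
          ((∫ s in (0 : ℝ)..t, ‖H s‖) ^ k / k.factorial))) ?_ ?_ ?_ ?_ ?_
      · intro k
        exact (((dysonTerm_isPrimitive hH k).2.integrable t ht).def').aestronglyMeasurable
      · intro k
        refine Filter.Eventually.of_forall fun s hs => ?_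
        rw [uIoc_of_le ht] at hs
        rw [norm_smul, norm_neg, Complex.norm_I, one_mul]
        refine (norm_mul_le _ _).trans ?_
        gcongr
        exact norm_dysonTerm_le_of_le hH k hs.1.le hs.2
      · exact Filter.Eventually.of_forall fun s _ => hsum.mul_left _
      · simp_rw [tsum_mul_left]
        exact (hH t).norm.mul_const _
      · refine Filter.Eventually.of_forall fun s hs => ?_
        rw [uIoc_of_le ht] at hs
        exact ((hasSum_dysonTerm hH hs.1.le).mul_left _).const_smul _
    have h3 := (hasSum_nat_add_iff' 1).2 h1
    rw [Finset.sum_range_one] at h3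
    rw [timeOrderedExp_zero, h2.unique h3]
    simp [dysonTerm]

end Dyson

/-! ### Unitary evolutions, Duhamel estimates and growth of commutators. -/

section Evolution

/-- `U` is the unitary evolution from time `0` generated by `H`. -/
structure IsEvolution {A : Type*} [CStarAlgebra A] (H U : ℝ → A) : Prop where
  zero : U 0 = 1
  isPrimitive : IsPrimitive U (fun s => (-Complex.I) • (H s * U s))
  star_mul_self : ∀ t, 0 ≤ t → star (U t) * U t = 1
  mul_star_self : ∀ t, 0 ≤ t → U t * star (U t) = 1

/-- The derivative of U†U vanishes because H is self-adjoint; UU† = 1 then follows from finite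
dimension. -/
theorem timeOrderedExp_isEvolution {n : Type*} [Fintype n] [DecidableEq n]
    {H : ℝ → Matrix n n ℂ} (hH : ∀ t, IntervalIntegrable H volume 0 t)
    (hs : ∀ s, IsSelfAdjoint (H s)) : IsEvolution H (timeOrderedExp H 0) := by
  have hp := timeOrderedExp_isPrimitive hH
  have h1 : ∀ t, 0 ≤ t → star (timeOrderedExp H 0 t) * timeOrderedExp H 0 t = 1 := by
    intro t ht
    have h2 := (hp.star.mul hp).congr (g := fun _ => 0) fun s _ => by
      simp [(hs s).star_eq, mul_assoc]
    have := h2.eq t ht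
    simpa [timeOrderedExp_zero] using this
  exact ⟨timeOrderedExp_zero, hp, h1, fun t ht => mul_eq_one_comm.1 (h1 t ht)⟩

namespace IsEvolution

variable {A : Type*} [CStarAlgebra A] {H U : ℝ → A}

theorem mem_unitary (h : IsEvolution H U) {t : ℝ} (ht : 0 ≤ t) : U t ∈ unitary A :=
  ⟨h.star_mul_self t ht, h.mul_star_self t ht⟩

theorem star_mem_unitary (h : IsEvolution H U) {t : ℝ} (ht : 0 ≤ t) : star (U t) ∈ unitary A :=
  Unitary.star_mem (h.mem_unitary ht)

theorem isPrimitive_star (h : IsEvolution H U) (hs : ∀ s, IsSelfAdjoint (H s)) :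
    IsPrimitive (fun s => star (U s)) (fun s => Complex.I • (star (U s) * H s)) :=
  h.isPrimitive.star.congr fun s _ => by simp [(hs s).star_eq]

/-- An operator evolving under `Y' = -i (G₁ Y - Y G₂) + e` with self-adjoint `G₁` and `G₂` grows at
most by the integral of the norm of the source `e`. -/
theorem norm_le_of_isPrimitive {G₁ G₂ U₁ U₂ Y e : ℝ → A} (h₁ : IsEvolution G₁ U₁)
    (h₂ : IsEvolution G₂ U₂) (hG₁ : ∀ s, IsSelfAdjoint (G₁ s))
    (hY : IsPrimitive Y (fun s => (-Complex.I) • (G₁ s * Y s - Y s * G₂ s) + e s))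
    (hY0 : Y 0 = 0) {B b : ℝ → ℝ} (hB : IsPrimitive B b) {t : ℝ} (ht : 0 ≤ t)
    (heb : ∀ s, 0 ≤ s → ‖e s‖ ≤ b s) : ‖Y t‖ ≤ B t - B 0 := by
  -- Interaction picture: U₁† Y U₂ has derivative U₁† e U₂, and unitary factors do not change norms.
  have hZ := (((h₁.isPrimitive_star hG₁).mul hY).mul h₂.isPrimitive).congr
    (g := fun s => star (U₁ s) * e s * U₂ s) fun s _ => by
      simp only [smul_mul_assoc, mul_smul_comm, mul_add, add_mul, mul_sub, sub_mul, smul_sub,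
        neg_smul, mul_neg, neg_mul, mul_assoc]
      abel
  have h3 := hZ.norm_le ht
  have e1 : ‖star (U₁ t) * Y t * U₂ t‖ = ‖Y t‖ := by
    rw [CStarRing.norm_mul_mem_unitary _ (h₂.mem_unitary ht),
      CStarRing.norm_mem_unitary_mul _ (h₁.star_mem_unitary ht)]
  rw [e1, hY0, mul_zero, zero_mul, norm_zero, zero_add] at h3
  rw [hB.eq t ht, add_sub_cancel_left]
  refine h3.trans (intervalIntegral.integral_mono_on ht (hZ.integrable t ht).norm
    (hB.integrable t ht) fun s hs => ?_)
  rw [CStarRing.norm_mul_mem_unitary _ (h₂.mem_unitary hs.1),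
      CStarRing.norm_mem_unitary_mul _ (h₁.star_mem_unitary hs.1)]
  exact heb s hs.1

theorem zero_one : IsEvolution (fun _ => (0 : A)) (fun _ => 1) where
  zero := rfl
  isPrimitive := by simpa using IsPrimitive.const (1 : A)
  star_mul_self := by simp
  mul_star_self := by simp

/-- The commutator Y = [M,U] starts at 0 and solves Y' = -iHY without a source, so it stays 0. -/
theorem commute {M : A} (h : IsEvolution H U) (hs : ∀ s, IsSelfAdjoint (H s))
    (hc : ∀ s, Commute M (H s)) {t : ℝ} (ht : 0 ≤ t) : Commute M (U t) := by
  have hY := (((IsPrimitive.const M).mul h.isPrimitive).sub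
    (h.isPrimitive.mul (IsPrimitive.const M))).congr
    (g := fun s => (-Complex.I) • (H s * (M * U s - U s * M) - (M * U s - U s * M) * 0) + 0)
    fun s _ => by
      have e : M * (H s * U s) = H s * (M * U s) := by rw [← mul_assoc, hc s, mul_assoc]
      simp only [zero_mul, mul_zero, zero_add, add_zero, sub_zero, mul_smul_comm, smul_mul_assoc,
        mul_sub, smul_sub, mul_assoc, e]
  have := norm_le_of_isPrimitive h zero_one hs hY (by simp [h.zero]) (IsPrimitive.const (0 : ℝ)) ht
    (by simp)
  rw [sub_self, norm_le_zero_iff, sub_eq_zero] at this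
  exact this

theorem isPrimitive_mul_star {H₁ H₂ U₁ U₂ : ℝ → A} (h₁ : IsEvolution H₁ U₁)
    (h₂ : IsEvolution H₂ U₂) (hs₂ : ∀ s, IsSelfAdjoint (H₂ s)) :
    IsPrimitive (fun s => U₁ s * star (U₂ s)) (fun s => (-Complex.I) •
      (H₁ s * (U₁ s * star (U₂ s)) - (U₁ s * star (U₂ s)) * H₂ s)) :=
  (h₁.isPrimitive.mul (h₂.isPrimitive_star hs₂)).congr fun s _ => by
    simp only [smul_mul_assoc, mul_smul_comm, smul_sub, neg_smul, neg_mul, mul_assoc]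
    abel

theorem isPrimitive_conj (h : IsEvolution H U) (hs : ∀ s, IsSelfAdjoint (H s)) (q : A) :
    IsPrimitive (fun s => U s * q * star (U s)) (fun s => (-Complex.I) •
      (H s * (U s * q * star (U s)) - (U s * q * star (U s)) * H s)) :=
  ((h.isPrimitive.mul (IsPrimitive.const q)).mul (h.isPrimitive_star hs)).congr fun s _ => by
    simp only [smul_mul_assoc, mul_smul_comm, smul_sub, neg_smul, neg_mul, mul_assoc, mul_zero, add_zero]
    abel

/-- The growth of the commutator of an operator with the relative evolution `U₁ U₂†` is governed
by the part `L` common to the generators `H₁` and `H₂` that does not commute with the operator, and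
by the part `L'` of `H₁` alone; the internal part `P`, which is common to both generators, and the
parts `M₁` and `M₂` commuting with the operator do not contribute. -/
theorem norm_commutator_le {P M₁ M₂ L L' H₁ H₂ UP U₁ U₂ V₁ V₂ : ℝ → A} (hUP : IsEvolution P UP)
    (hU₁ : IsEvolution H₁ U₁) (hU₂ : IsEvolution H₂ U₂)
    (hV₁ : IsEvolution (fun s => P s + M₁ s) V₁) (hV₂ : IsEvolution (fun s => P s + M₂ s) V₂)
    (hP : ∀ s, IsSelfAdjoint (P s)) (hM₁ : ∀ s, IsSelfAdjoint (M₁ s))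
    (hH₂ : ∀ s, IsSelfAdjoint (H₂ s))
    (e₁ : ∀ s, H₁ s = P s + M₁ s + L s + L' s) (e₂ : ∀ s, H₂ s = P s + M₂ s + L s)
    {Q : A} {T : ℝ} (hT : 0 ≤ T)
    (hc : ∀ s, 0 ≤ s → ∀ q, q = UP s * (star (UP T) * Q * UP T) * star (UP s) →
      Commute (M₁ s) q ∧ Commute (M₂ s) q)
    {B b : ℝ → ℝ} (hB : IsPrimitive B b)
    (hb : ∀ s, 0 ≤ s → 2 * ‖Q‖ * (‖L s * (U₁ s * star (U₂ s)) - (U₁ s * star (U₂ s)) * L s‖ +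
      ‖L' s‖) ≤ b s) :
    ‖Q * (U₁ T * star (U₂ T)) - (U₁ T * star (U₂ T)) * Q‖ ≤ B T - B 0 := by
  -- The initial value `q` is chosen so that its evolution under P equals Q at the final time T. The
  -- motion of this operator cancels the commutators with P exactly.
  set q : A := star (UP T) * Q * UP T with hq
  have hQn : ∀ s, 0 ≤ s → ‖UP s * q * star (UP s)‖ = ‖Q‖ := fun s hs => by
    rw [CStarRing.norm_mul_mem_unitary _ (hUP.star_mem_unitary hs),
      CStarRing.norm_mem_unitary_mul _ (hUP.mem_unitary hs), hq,
      CStarRing.norm_mul_mem_unitary _ (hUP.mem_unitary hT),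
      CStarRing.norm_mem_unitary_mul _ (hUP.star_mem_unitary hT)]
  have hQT : UP T * q * star (UP T) = Q := by
    rw [hq, mul_assoc (star (UP T)), ← mul_assoc (UP T), hUP.mul_star_self T hT, one_mul, mul_assoc,
      hUP.mul_star_self T hT, mul_one]
  have hRu : ∀ s, 0 ≤ s → U₁ s * star (U₂ s) ∈ unitary A := fun s hs =>
    mul_mem (hU₁.mem_unitary hs) (hU₂.star_mem_unitary hs)
  have hQ := hUP.isPrimitive_conj hP q
  have hR := hU₁.isPrimitive_mul_star hU₂ hH₂
  have hR0 : U₁ 0 * star (U₂ 0) = 1 := by simp [hU₁.zero, hU₂.zero]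
  have key := ((hQ.mul hR).sub (hR.mul hQ))
  rw [← hQT]
  generalize hRdef : (fun s => U₁ s * star (U₂ s)) = R at hR key
  generalize hQdef : (fun s => UP s * q * star (UP s)) = Qs at hQ key
  have hRa : ∀ s, U₁ s * star (U₂ s) = R s := fun s => congrFun hRdef s
  have hQa : ∀ s, UP s * q * star (UP s) = Qs s := fun s => congrFun hQdef s
  simp only [hRa, hQa] at *
  refine norm_le_of_isPrimitive hV₁ hV₂ (fun s => (hP s).add (hM₁ s))
    (Y := fun s => Qs s * R s - R s * Qs s)
    (e := fun s => (-Complex.I) • (Qs s * (L s * R s - R s * L s) - (L s * R s - R s * L s) * Qs s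
      + (Qs s * (L' s * R s) - L' s * R s * Qs s)))
    (key.congr fun s hs => ?_) (by simp [hR0]) hB hT fun s hs => ?_
  · obtain ⟨c₁, c₂⟩ := hc s hs _ rfl
    have d₁ : Qs s * M₁ s - M₁ s * Qs s = 0 := by rw [c₁.eq, sub_self]
    have d₂ : M₂ s * Qs s - Qs s * M₂ s = 0 := by rw [c₂.eq, sub_self]
    have h1 : Qs s * (H₁ s * R s - R s * H₂ s) + (P s * Qs s - Qs s * P s) * R s
        - (H₁ s * R s - R s * H₂ s) * Qs s - R s * (P s * Qs s - Qs s * P s) =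
        (P s + M₁ s) * (Qs s * R s - R s * Qs s) - (Qs s * R s - R s * Qs s) * (P s + M₂ s)
        + (Qs s * (L s * R s - R s * L s) - (L s * R s - R s * L s) * Qs s
          + (Qs s * (L' s * R s) - L' s * R s * Qs s))
        + (Qs s * M₁ s - M₁ s * Qs s) * R s + R s * (M₂ s * Qs s - Qs s * M₂ s) := by
      rw [e₁, e₂]
      noncomm_ring
    rw [d₁, d₂, zero_mul, mul_zero, add_zero, add_zero] at h1
    rw [← smul_add, ← h1]
    simp only [smul_mul_assoc, mul_smul_comm, smul_sub, smul_add, sub_mul, mul_sub, mul_assoc, neg_smul,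
      neg_mul, mul_neg]
    abel
  · rw [norm_smul, norm_neg, Complex.norm_I, one_mul]
    refine le_trans ?_ (hb s hs)
    have n1 : ‖Qs s * (L s * R s - R s * L s)‖ ≤ ‖Q‖ * ‖L s * R s - R s * L s‖ :=
      (norm_mul_le _ _).trans_eq (by rw [hQn s hs])
    have n2 : ‖(L s * R s - R s * L s) * Qs s‖ ≤ ‖L s * R s - R s * L s‖ * ‖Q‖ :=
      (norm_mul_le _ _).trans_eq (by rw [hQn s hs])
    have n3 : ‖Qs s * (L' s * R s)‖ ≤ ‖Q‖ * ‖L' s‖ := (norm_mul_le _ _).trans_eq (by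
      rw [hQn s hs, CStarRing.norm_mul_mem_unitary _ (hRu s hs)])
    have n4 : ‖L' s * R s * Qs s‖ ≤ ‖L' s‖ * ‖Q‖ := (norm_mul_le _ _).trans_eq (by
      rw [hQn s hs, CStarRing.norm_mul_mem_unitary _ (hRu s hs)])
    have n5 := norm_add_le (Qs s * (L s * R s - R s * L s) - (L s * R s - R s * L s) * Qs s)
      (Qs s * (L' s * R s) - L' s * R s * Qs s)
    have n6 := norm_sub_le (Qs s * (L s * R s - R s * L s)) ((L s * R s - R s * L s) * Qs s)
    have n7 := norm_sub_le (Qs s * (L' s * R s)) (L' s * R s * Qs s)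
    nlinarith

end IsEvolution

end Evolution

/-! ### Truncated exponential series of a nonnegative kernel. -/

section PathWeights

variable {ι : Type*} [Fintype ι]

/-- The `m`-fold application of the kernel `w` to `g`. -/
def kernelIter (w : ι → ι → ℝ) (g : ι → ℝ) : ℕ → ι → ℝ
  | 0, x => g x
  | m + 1, x => ∑ z, w x z * kernelIter w g m z

/-- The first `n` terms of the series for `exp (c t w) g`. -/
noncomputable def expPartialSum (w : ι → ι → ℝ) (g : ι → ℝ) (c : ℝ) (n : ℕ) (t : ℝ) (x : ι) : ℝ :=
  ∑ m ∈ Finset.range n, (c * t) ^ m / m.factorial * kernelIter w g m x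

variable {w : ι → ι → ℝ} {g : ι → ℝ} {c : ℝ}

theorem kernelIter_nonneg (hw : ∀ x z, 0 ≤ w x z) (hg : ∀ x, 0 ≤ g x) (m : ℕ) :
    ∀ x, 0 ≤ kernelIter w g m x := by
  induction m with
  | zero => exact hg
  | succ m ih => exact fun x => Finset.sum_nonneg fun z _ => mul_nonneg (hw x z) (ih z)

theorem expPartialSum_nonneg (hw : ∀ x z, 0 ≤ w x z) (hg : ∀ x, 0 ≤ g x) (hc : 0 ≤ c) (n : ℕ)
    {t : ℝ} (ht : 0 ≤ t) (x : ι) : 0 ≤ expPartialSum w g c n t x :=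
  Finset.sum_nonneg fun m _ => mul_nonneg (by positivity) (kernelIter_nonneg hw hg m x)

theorem le_expPartialSum_succ (hw : ∀ x z, 0 ≤ w x z) (hg : ∀ x, 0 ≤ g x) (hc : 0 ≤ c) (n : ℕ)
    {t : ℝ} (ht : 0 ≤ t) (x : ι) : g x ≤ expPartialSum w g c (n + 1) t x := by
  rw [expPartialSum, Finset.sum_range_succ']
  simp only [pow_zero, Nat.factorial_zero, Nat.cast_one, div_one, one_mul]
  exact le_add_of_nonneg_left (Finset.sum_nonneg fun m _ =>
    mul_nonneg (by positivity) (kernelIter_nonneg hw hg _ x))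

theorem IsPrimitive.sum {κ E : Type*} [NormedAddCommGroup E] [NormedSpace ℝ E] (s : Finset κ)
    {F f : κ → ℝ → E} (h : ∀ i ∈ s, IsPrimitive (F i) (f i)) :
    IsPrimitive (fun t => ∑ i ∈ s, F i t) (fun t => ∑ i ∈ s, f i t) := by
  classical
  induction s using Finset.induction_on with
  | empty => simpa using IsPrimitive.const (0 : E)
  | insert a s ha ih =>
    simp only [Finset.sum_insert ha]
    exact (h a (Finset.mem_insert_self a s)).add (ih fun i hi => h i (Finset.mem_insert_of_mem hi))

theorem IsPrimitive.const_mul {F f : ℝ → ℝ} (h : IsPrimitive F f) (c : ℝ) :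
    IsPrimitive (fun t => c * F t) (fun t => c * f t) :=
  h.clm (ContinuousLinearMap.mul ℝ ℝ c)

theorem isPrimitive_pow_div_factorial (c : ℝ) (k : ℕ) :
    IsPrimitive (fun t : ℝ => (c * t) ^ (k + 1) / (k + 1).factorial)
      (fun t => c * ((c * t) ^ k / k.factorial)) := by
  refine IsPrimitive.pow_succ_div_factorial (m := fun t => c * t) (f := fun _ => c)
    ⟨fun t _ => intervalIntegrable_const, fun t _ => ?_⟩ k
  simp [mul_comm]

/-- Differentiating lowers the truncation order by one and applies c·w. An induction on the order
can therefore replace a Grönwall argument. -/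
theorem expPartialSum_isPrimitive (n : ℕ) (x : ι) :
    IsPrimitive (fun t => expPartialSum w g c (n + 1) t x)
      (fun t => c * ∑ z, w x z * expPartialSum w g c n t z) := by
  have h := (IsPrimitive.const (g x)).add (IsPrimitive.sum (Finset.range n) fun m _ =>
    (isPrimitive_pow_div_factorial c m).const_mul (kernelIter w g (m + 1) x))
  refine (funext fun t => ?_ : (fun t => expPartialSum w g c (n + 1) t x) = _) ▸
    h.congr fun t _ => ?_
  · rw [expPartialSum, Finset.sum_range_succ', add_comm]
    simp [kernelIter, mul_comm]
  · simp only [zero_add, expPartialSum, Finset.mul_sum, kernelIter, Finset.sum_mul]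
    rw [Finset.sum_comm]
    refine Finset.sum_congr rfl fun z _ => Finset.sum_congr rfl fun m _ => by ring

end PathWeights

/-! ### Lieb–Robinson bound for the relative evolution, and the decomposition error. -/

section Interaction

variable {ι A : Type*} [CStarAlgebra A]

/-- The sum of the interaction terms of the pairs in `S`. -/
def interactionSum (h : ι → ι → ℝ → A) (S : Finset (ι × ι)) (s : ℝ) : A :=
  ∑ p ∈ S, h p.1 p.2 s

/-- A family of self-adjoint interaction terms, those on disjoint pairs commuting with each other,
that generates unitary evolutions and whose terms between different sites are bounded by a
symmetric kernel `w` with row sums at most `lam`. -/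
structure IsLocalSystem [Fintype ι] (h : ι → ι → ℝ → A) (w : ι → ι → ℝ) (lam : ℝ) : Prop where
  selfAdjoint : ∀ i j s, IsSelfAdjoint (h i j s)
  commute : ∀ i j k l s s', i ≠ k → i ≠ l → j ≠ k → j ≠ l → Commute (h i j s) (h k l s')
  exists_evolution : ∀ S : Finset (ι × ι), ∃ U, IsEvolution (interactionSum h S) U
  norm_le : ∀ i j s, i ≠ j → ‖h i j s‖ ≤ w i j
  nonneg : ∀ i j, 0 ≤ w i j
  symm : ∀ i j, w i j = w j i
  self : ∀ i, w i i = 1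
  sum_le : ∀ i, ∑ j, w i j ≤ lam

variable {h : ι → ι → ℝ → A} {w : ι → ι → ℝ} {lam : ℝ}

theorem interactionSum_union [DecidableEq ι] {S T : Finset (ι × ι)} (hST : Disjoint S T) (s : ℝ) :
    interactionSum h (S ∪ T) s = interactionSum h S s + interactionSum h T s :=
  Finset.sum_union hST

theorem norm_interactionSum_le (S : Finset (ι × ι)) (s : ℝ) :
    ‖interactionSum h S s‖ ≤ ∑ p ∈ S, ‖h p.1 p.2 s‖ :=
  norm_sum_le _ _

theorem norm_commutator_interactionSum_le (S : Finset (ι × ι)) (s : ℝ) (R : A) :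
    ‖interactionSum h S s * R - R * interactionSum h S s‖ ≤
      ∑ p ∈ S, ‖h p.1 p.2 s * R - R * h p.1 p.2 s‖ := by
  rw [interactionSum, Finset.sum_mul, Finset.mul_sum, ← Finset.sum_sub_distrib]
  exact norm_sum_le _ _

variable [Fintype ι]

/-- `expBound` dominates the norm of the commutator of `U₁ U₂†` with an operator of norm `1/2` on
the site `x`. -/
noncomputable def expBound [DecidableEq ι] (w : ι → ι → ℝ) (lam : ℝ) (a : Finset ι) (n : ℕ) (t : ℝ) (x : ι) : ℝ :=
  expPartialSum w (fun x => if x ∈ a then 1 else 0) (4 * (lam + 1)) n t x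

namespace IsLocalSystem

theorem isSelfAdjoint_interactionSum (hh : IsLocalSystem h w lam) (S : Finset (ι × ι)) (s : ℝ) :
    IsSelfAdjoint (interactionSum h S s) :=
  isSelfAdjoint_sum _ fun _ _ => hh.selfAdjoint _ _ _

theorem one_le (hh : IsLocalSystem h w lam) (x : ι) : 1 ≤ lam := by
  refine le_trans ?_ (hh.sum_le x)
  rw [← hh.self x]
  exact Finset.single_le_sum (fun z _ => hh.nonneg x z) (Finset.mem_univ x)

variable [DecidableEq ι]

theorem expBound_nonneg (hh : IsLocalSystem h w lam) (a : Finset ι) (n : ℕ) {t : ℝ} (ht : 0 ≤ t)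
    (x : ι) : 0 ≤ expBound w lam a n t x :=
  expPartialSum_nonneg hh.nonneg (fun x => by split_ifs <;> norm_num)
    (by have := hh.one_le x; linarith) n ht x

/-- For n > 0 the zeroth term is already 1 on `a`; for n = 0 the partial sum is empty and the
remainder term equals 1. Trivial norm bounds are thus admissible for whatever touches `a`. -/
theorem one_le_expBound (hh : IsLocalSystem h w lam) {a : Finset ι} (n : ℕ) {t : ℝ} (ht : 0 ≤ t)
    {x : ι} (hx : x ∈ a) :
    1 ≤ expBound w lam a n t x + (8 * lam * t) ^ n / n.factorial := by
  have h1 := hh.one_le x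
  cases n with
  | zero => simpa using hh.expBound_nonneg a 0 ht x
  | succ n =>
    have h2 := le_expPartialSum_succ hh.nonneg (g := fun x => if x ∈ a then (1 : ℝ) else 0)
      (fun x => by split_ifs <;> norm_num) (show (0 : ℝ) ≤ 4 * (lam + 1) by linarith) n ht x
    rw [if_pos hx] at h2
    exact h2.trans (le_add_of_nonneg_right (by positivity))

/-- The sum over the second site of the commutator bounds for the terms `h i z`. -/
theorem sum_pair_le (hh : IsLocalSystem h w lam) (a : Finset ι) (n : ℕ) {t : ℝ} (ht : 0 ≤ t)
    (x : ι) : ∑ z, w x z * (expBound w lam a n t x + expBound w lam a n t z +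
        (8 * lam * t) ^ n / n.factorial) ≤
      (lam + 1) * ∑ z, w x z * expBound w lam a n t z + lam * ((8 * lam * t) ^ n / n.factorial) := by
  have h1 := hh.one_le x
  have e : ∑ z, w x z * (expBound w lam a n t x + expBound w lam a n t z +
      (8 * lam * t) ^ n / n.factorial) = (∑ z, w x z) * expBound w lam a n t x +
        ∑ z, w x z * expBound w lam a n t z + (∑ z, w x z) * ((8 * lam * t) ^ n / n.factorial) := by
    simp only [mul_add, Finset.sum_add_distrib, Finset.sum_mul]
  -- The diagonal weight 1 absorbs the value at `x` itself into the kernel sum; this turns `lam`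
  -- into `lam + 1`.
  have h2 : expBound w lam a n t x ≤ ∑ z, w x z * expBound w lam a n t z := by
    have := Finset.single_le_sum (f := fun z => w x z * expBound w lam a n t z)
      (fun z _ => mul_nonneg (hh.nonneg x z) (hh.expBound_nonneg a n ht z)) (Finset.mem_univ x)
    simpa [hh.self x] using this
  have h3 := hh.sum_le x
  have h4 := hh.expBound_nonneg a n ht x
  have h5 : (0 : ℝ) ≤ (8 * lam * t) ^ n / n.factorial := by positivity
  rw [e]
  nlinarith [mul_le_mul_of_nonneg_right h3 h4, mul_le_mul_of_nonneg_right h3 h5]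

/-- Each ordered pair is charged to an end in `X`, which may be its first or its second entry. By
symmetry of w both cases give the same sum, so the 2 of the summand becomes 4. -/
theorem sum_pairs_le (hh : IsLocalSystem h w lam) (S : Finset (ι × ι)) (f : ι → ℝ)
    (hf : ∀ x, 0 ≤ f x) (e : ℝ) (he : 0 ≤ e) (X : Finset ι) (hS : ∀ p ∈ S, p.1 ∈ X ∨ p.2 ∈ X) :
    ∑ p ∈ S, 2 * w p.1 p.2 * (f p.1 + f p.2 + e) ≤
      4 * ∑ x ∈ X, ∑ z, w x z * (f x + f z + e) := by
  have hnn : ∀ x z, 0 ≤ w x z * (f x + f z + e) := fun x z =>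
    mul_nonneg (hh.nonneg x z) (by linarith [hf x, hf z])
  have hsub : S ⊆ (X ×ˢ Finset.univ) ∪ (Finset.univ ×ˢ X) := fun p hp => by
    simpa using hS p hp
  calc ∑ p ∈ S, 2 * w p.1 p.2 * (f p.1 + f p.2 + e)
      = 2 * ∑ p ∈ S, w p.1 p.2 * (f p.1 + f p.2 + e) := by
        rw [Finset.mul_sum]; exact Finset.sum_congr rfl fun _ _ => by ring
    _ ≤ 2 * (∑ p ∈ X ×ˢ Finset.univ, w p.1 p.2 * (f p.1 + f p.2 + e) +
          ∑ p ∈ Finset.univ ×ˢ X, w p.1 p.2 * (f p.1 + f p.2 + e)) := by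
        gcongr
        refine (Finset.sum_le_sum_of_subset_of_nonneg hsub fun p _ _ => hnn p.1 p.2).trans ?_
        rw [← Finset.sum_union_inter]
        exact le_add_of_nonneg_right (Finset.sum_nonneg fun p _ => hnn p.1 p.2)
    _ = 2 * (∑ x ∈ X, ∑ z, w x z * (f x + f z + e) +
          ∑ x ∈ X, ∑ z, w x z * (f x + f z + e)) := by
        rw [Finset.sum_product, Finset.sum_product_right]
        congr 2
        refine Finset.sum_congr rfl fun x _ => Finset.sum_congr rfl fun z _ => ?_
        rw [hh.symm z x]; ring
    _ = _ := by ring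

variable {U₁ U₂ : ℝ → A} {a b : Finset ι}

set_option maxHeartbeats 1000000 in
-- Lieb–Robinson bound by Picard iteration in `n`. For x, y outside `a`, only terms joining {x,y} to
-- other sites feed the commutator: those within `b` through their own commutators with the relative
-- evolution, which the previous order bounds, and those reaching `a` through their norms. If x or y
-- lies in `a`, the bound 2‖Q‖ suffices. The commutation hypothesis on Q stands in for support on
-- {x,y}.
theorem norm_commutator_le (hh : IsLocalSystem h w lam) (hab : Disjoint a b)
    (hU₁ : IsEvolution (interactionSum h ((a ∪ b) ×ˢ (a ∪ b))) U₁)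
    (hU₂ : IsEvolution (interactionSum h (b ×ˢ b)) U₂) (n : ℕ) :
    ∀ (t : ℝ), 0 ≤ t → ∀ (x y : ι) (Q : A),
      (∀ k l s, k ≠ x → k ≠ y → l ≠ x → l ≠ y → Commute (h k l s) Q) →
      ‖Q * (U₁ t * star (U₂ t)) - (U₁ t * star (U₂ t)) * Q‖ ≤
        2 * ‖Q‖ * (expBound w lam a n t x + expBound w lam a n t y +
          (8 * lam * t) ^ n / n.factorial) := by
  have triv : ∀ (n : ℕ) (t : ℝ), 0 ≤ t → ∀ (x y : ι) (Q : A),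
      1 ≤ expBound w lam a n t x + expBound w lam a n t y + (8 * lam * t) ^ n / n.factorial →
      ‖Q * (U₁ t * star (U₂ t)) - (U₁ t * star (U₂ t)) * Q‖ ≤
        2 * ‖Q‖ * (expBound w lam a n t x + expBound w lam a n t y +
          (8 * lam * t) ^ n / n.factorial) := by
    intro n t ht x y Q h1
    have hR : U₁ t * star (U₂ t) ∈ unitary A :=
      mul_mem (hU₁.mem_unitary ht) (hU₂.star_mem_unitary ht)
    have h2 := norm_sub_le (Q * (U₁ t * star (U₂ t))) ((U₁ t * star (U₂ t)) * Q)
    rw [CStarRing.norm_mul_mem_unitary _ hR, CStarRing.norm_mem_unitary_mul _ hR] at h2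
    nlinarith [norm_nonneg Q]
  induction n with
  | zero =>
    intro t ht x y Q _
    exact triv 0 t ht x y Q (by simp [expBound, expPartialSum])
  | succ n ih =>
    intro t ht x y Q hQ
    by_cases hx : x ∈ a
    · refine triv _ t ht x y Q ?_
      have := hh.one_le_expBound (n + 1) ht hx
      linarith [hh.expBound_nonneg a (n + 1) ht y]
    by_cases hy : y ∈ a
    · refine triv _ t ht x y Q ?_
      have := hh.one_le_expBound (n + 1) ht hy
      linarith [hh.expBound_nonneg a (n + 1) ht x]
    have hlam := hh.one_le x
    set X : Finset ι := {x, y} with hX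
    have hXa : ∀ i ∈ X, i ∉ a := by simp [hX, hx, hy]
    have hXm : ∀ i, i ∉ X → i ≠ x ∧ i ≠ y := by simp [hX]
    -- the pairs in `b` inside `X`, off `X`, and across the boundary of `X`
    set SP := (b ×ˢ b).filter fun p => p.1 ∈ X ∧ p.2 ∈ X
    set SM₂ := (b ×ˢ b).filter fun p => p.1 ∉ X ∧ p.2 ∉ X
    set SL := (b ×ˢ b).filter fun p => ¬(p.1 ∈ X ∧ p.2 ∈ X) ∧ ¬(p.1 ∉ X ∧ p.2 ∉ X)
    set SM₁ := ((a ∪ b) ×ˢ (a ∪ b)).filter fun p => p.1 ∉ X ∧ p.2 ∉ X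
    -- The pairs joining `X` to `a`, which occur in the first generator only.
    set SL' := ((a ∪ b) ×ˢ (a ∪ b)).filter fun p => ¬(p.1 ∉ X ∧ p.2 ∉ X) ∧ (p.1 ∈ a ∨ p.2 ∈ a)
    have hab' : ∀ i ∈ a, i ∉ b := fun i hi hi' => Finset.disjoint_left.1 hab hi hi'
    have e₂ : ∀ s, interactionSum h (b ×ˢ b) s =
        interactionSum h SP s + interactionSum h SM₂ s + interactionSum h SL s := by
      intro s
      rw [← interactionSum_union, ← interactionSum_union]
      · congr 1
        ext p
        simp only [SP, SM₂, SL, Finset.mem_union, Finset.mem_filter]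
        grind
      · rw [Finset.disjoint_left]
        intro p
        simp only [SP, SM₂, SL, Finset.mem_union, Finset.mem_filter]
        grind
      · rw [Finset.disjoint_left]
        intro p
        simp only [SP, SM₂, Finset.mem_filter]
        grind
    have e₁ : ∀ s, interactionSum h ((a ∪ b) ×ˢ (a ∪ b)) s =
        interactionSum h SP s + interactionSum h SM₁ s + interactionSum h SL s +
          interactionSum h SL' s := by
      intro s
      rw [← interactionSum_union, ← interactionSum_union, ← interactionSum_union]
      · congr 1
        ext p
        simp only [SP, SM₁, SL, SL', Finset.mem_union, Finset.mem_filter, Finset.mem_product]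
        grind
      · rw [Finset.disjoint_left]
        intro p
        simp only [SP, SM₁, SL, SL', Finset.mem_union, Finset.mem_filter, Finset.mem_product]
        grind
      · rw [Finset.disjoint_left]
        intro p
        simp only [SP, SM₁, SL, Finset.mem_union, Finset.mem_filter]
        grind
      · rw [Finset.disjoint_left]
        intro p
        simp only [SP, SM₁, Finset.mem_filter]
        grind
    have sa := hh.isSelfAdjoint_interactionSum
    obtain ⟨UP, hUP⟩ := hh.exists_evolution SP
    obtain ⟨V₁, hV₁⟩ := hh.exists_evolution (SP ∪ SM₁)
    obtain ⟨V₂, hV₂⟩ := hh.exists_evolution (SP ∪ SM₂)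
    have hV₁' : IsEvolution (fun s => interactionSum h SP s + interactionSum h SM₁ s) V₁ := by
      convert hV₁ using 1
      ext s
      refine (interactionSum_union ?_ s).symm
      rw [Finset.disjoint_left]
      intro p
      simp only [SP, SM₁, Finset.mem_filter]
      tauto
    have hV₂' : IsEvolution (fun s => interactionSum h SP s + interactionSum h SM₂ s) V₂ := by
      convert hV₂ using 1
      ext s
      refine (interactionSum_union ?_ s).symm
      rw [Finset.disjoint_left]
      intro p
      simp only [SP, SM₂, Finset.mem_filter]
      tauto
    -- terms off `X` commute with the evolution inside `X`
    have hcUP : ∀ k l s u, 0 ≤ u → k ∉ X → l ∉ X → Commute (h k l s) (UP u) := by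
      intro k l s u hu hk hl
      refine hUP.commute (sa SP) (fun s' => ?_) hu
      refine Commute.sum_right _ _ _ fun p hp => ?_
      obtain ⟨-, h1, h2⟩ := Finset.mem_filter.1 hp
      exact hh.commute _ _ _ _ _ _ (fun e => hk (e ▸ h1)) (fun e => hk (e ▸ h2))
        (fun e => hl (e ▸ h1)) (fun e => hl (e ▸ h2))
    have hcQ : ∀ k l s u, 0 ≤ u → k ∉ X → l ∉ X →
        Commute (h k l s) (UP u * (star (UP t) * Q * UP t) * star (UP u)) := by
      intro k l s u hu hk hl
      have c1 := hcUP k l s u hu hk hl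
      have c2 := hcUP k l s t ht hk hl
      have st : ∀ {V : A}, Commute (h k l s) V → Commute (h k l s) (star V) := fun {V} hc => by
        have := hc.star_star
        rwa [(hh.selfAdjoint k l s).star_eq] at this
      exact (c1.mul_right (((st c2).mul_right (hQ k l s (hXm k hk).1 (hXm k hk).2 (hXm l hl).1
        (hXm l hl).2)).mul_right c2)).mul_right (st c1)
    -- the bound and its primitive
    have hB := (((expPartialSum_isPrimitive (w := w) (g := fun x => if x ∈ a then (1 : ℝ) else 0)
      (c := 4 * (lam + 1)) n x).add (expPartialSum_isPrimitive (w := w)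
        (g := fun x => if x ∈ a then (1 : ℝ) else 0) (c := 4 * (lam + 1)) n y)).add
          (isPrimitive_pow_div_factorial (8 * lam) n)).const_mul (2 * ‖Q‖)
    refine (IsEvolution.norm_commutator_le hUP hU₁ hU₂ hV₁' hV₂' (sa SP) (sa SM₁) (sa (b ×ˢ b))
      e₁ e₂ ht (fun s hs q hq => ?_) hB fun s hs => ?_).trans ?_
    · rw [hq]
      refine ⟨Commute.sum_left _ _ _ fun p hp => ?_, Commute.sum_left _ _ _ fun p hp => ?_⟩
      · obtain ⟨-, h1, h2⟩ := Finset.mem_filter.1 hp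
        exact hcQ _ _ _ _ hs h1 h2
      · obtain ⟨-, h1, h2⟩ := Finset.mem_filter.1 hp
        exact hcQ _ _ _ _ hs h1 h2
    · refine mul_le_mul_of_nonneg_left ?_ (by positivity)
      have hE : (0 : ℝ) ≤ (8 * lam * s) ^ n / n.factorial := by positivity
      have hf := hh.expBound_nonneg a n hs
      have hL : ‖interactionSum h SL s * (U₁ s * star (U₂ s)) -
          (U₁ s * star (U₂ s)) * interactionSum h SL s‖ ≤ ∑ p ∈ SL, 2 * w p.1 p.2 *
          (expBound w lam a n s p.1 + expBound w lam a n s p.2 +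
            (8 * lam * s) ^ n / n.factorial) := by
        refine (norm_commutator_interactionSum_le _ _ _).trans (Finset.sum_le_sum fun p hp => ?_)
        have hp' : p.1 ≠ p.2 := fun e => by
          have := (Finset.mem_filter.1 hp).2
          rw [e] at this
          tauto
        refine (ih s hs p.1 p.2 (h p.1 p.2 s) fun k l s' h1 h2 h3 h4 =>
          hh.commute _ _ _ _ _ _ h1 h2 h3 h4).trans ?_
        have := hf p.1
        have := hf p.2
        have := hh.norm_le _ _ s hp'
        gcongr
      have hL' : ‖interactionSum h SL' s‖ ≤ ∑ p ∈ SL', 2 * w p.1 p.2 *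
          (expBound w lam a n s p.1 + expBound w lam a n s p.2 +
            (8 * lam * s) ^ n / n.factorial) := by
        refine (norm_interactionSum_le _ _).trans (Finset.sum_le_sum fun p hp => ?_)
        obtain ⟨-, h1, h2⟩ := Finset.mem_filter.1 hp
        have hp' : p.1 ≠ p.2 := fun e => by
          have := hXa p.1
          rw [← e] at h1 h2
          tauto
        have h3 : 1 ≤ expBound w lam a n s p.1 + expBound w lam a n s p.2 +
            (8 * lam * s) ^ n / n.factorial := by
          rcases h2 with h2 | h2
          · linarith [hh.one_le_expBound n hs h2, hf p.2]
          · linarith [hh.one_le_expBound n hs h2, hf p.1]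
        have := hh.norm_le _ _ s hp'
        nlinarith [hh.nonneg p.1 p.2]
      have hdis : Disjoint SL SL' := by
        rw [Finset.disjoint_left]
        intro p
        have h1 := hab' p.1
        have h2 := hab' p.2
        simp only [SL, SL', Finset.mem_filter, Finset.mem_product]
        tauto
      refine (add_le_add hL hL').trans ?_
      rw [← Finset.sum_union hdis]
      refine (hh.sum_pairs_le _ _ hf _ hE X fun p hp => ?_).trans ?_
      · rcases Finset.mem_union.1 hp with hp | hp
        · have := (Finset.mem_filter.1 hp).2
          tauto
        · have := (Finset.mem_filter.1 hp).2
          tauto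
      · have hsub : ∑ i ∈ X, ∑ z, w i z * (expBound w lam a n s i + expBound w lam a n s z +
            (8 * lam * s) ^ n / n.factorial) ≤ ∑ i ∈ X,
            ((lam + 1) * ∑ z, w i z * expBound w lam a n s z +
              lam * ((8 * lam * s) ^ n / n.factorial)) :=
          Finset.sum_le_sum fun i _ => hh.sum_pair_le a n hs i
        have hnn : ∀ i, 0 ≤ (lam + 1) * ∑ z, w i z * expBound w lam a n s z +
            lam * ((8 * lam * s) ^ n / n.factorial) := fun i =>
          add_nonneg (mul_nonneg (by linarith) (Finset.sum_nonneg fun z _ =>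
            mul_nonneg (hh.nonneg i z) (hf z))) (mul_nonneg (by linarith) hE)
        -- If x = y the set `X` has one element and the right side is simply larger. With the
        -- prefactor 4, the two copies give the rate `4 * (lam + 1)` at each site and `8 * lam` for
        -- the remainder.
        have hpair : ∑ i ∈ X, ((lam + 1) * ∑ z, w i z * expBound w lam a n s z +
              lam * ((8 * lam * s) ^ n / n.factorial)) ≤
            ((lam + 1) * ∑ z, w x z * expBound w lam a n s z +
              lam * ((8 * lam * s) ^ n / n.factorial)) +
            ((lam + 1) * ∑ z, w y z * expBound w lam a n s z +
              lam * ((8 * lam * s) ^ n / n.factorial)) := by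
          by_cases hxy : x = y
          · rw [hX, hxy, Finset.pair_eq_singleton, Finset.sum_singleton]
            linarith [hnn y]
          · rw [hX, Finset.sum_pair hxy]
        simp only [expBound] at hsub hpair ⊢
        linarith
    · simp only [expBound]
      have := hh.expBound_nonneg a (n + 1) le_rfl x
      have := hh.expBound_nonneg a (n + 1) le_rfl y
      simp only [expBound] at *
      have h0 : (0 : ℝ) ≤ (8 * lam * 0) ^ (n + 1) / (n + 1).factorial := by positivity
      exact sub_le_self _ (by positivity)

set_option maxHeartbeats 1000000 in
/-- The error of replacing the evolution on all sites by the evolutions on `a ∪ b`, `b` and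
`b ∪ c`. -/
theorem norm_evolution_sub_le (hh : IsLocalSystem h w lam) (hlam : 1 ≤ lam) {c : Finset ι} (hab : Disjoint a b)
    (hac : Disjoint a c) (hbc : Disjoint b c) (huniv : a ∪ b ∪ c = Finset.univ) {U U₃ : ℝ → A}
    (hU : IsEvolution (interactionSum h Finset.univ) U)
    (hU₁ : IsEvolution (interactionSum h ((a ∪ b) ×ˢ (a ∪ b))) U₁)
    (hU₂ : IsEvolution (interactionSum h (b ×ˢ b)) U₂)
    (hU₃ : IsEvolution (interactionSum h ((b ∪ c) ×ˢ (b ∪ c))) U₃) (n : ℕ) {t : ℝ} (ht : 0 ≤ t) :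
    ‖U t - U₁ t * star (U₂ t) * U₃ t‖ ≤ ∑ j ∈ c, (expBound w lam a (n + 1) t j +
      (8 * lam * t) ^ (n + 1) / (n + 1).factorial) := by
  have sa := hh.isSelfAdjoint_interactionSum
  have hcover : ∀ i, i ∈ a ∨ i ∈ b ∨ i ∈ c := fun i => by
    have := huniv ▸ Finset.mem_univ i
    simpa [or_assoc] using this
  have hab' : ∀ i ∈ a, i ∉ b := fun i hi hi' => Finset.disjoint_left.1 hab hi hi'
  have hac' : ∀ i ∈ a, i ∉ c := fun i hi hi' => Finset.disjoint_left.1 hac hi hi'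
  have hbc' : ∀ i ∈ b, i ∉ c := fun i hi hi' => Finset.disjoint_left.1 hbc hi hi'
  -- `SK` are the pairs joining `b` and `c`, and `SV` those joining `a` and `c`
  set SK : Finset (ι × ι) := (b ×ˢ c) ∪ (c ×ˢ b)
  set SV : Finset (ι × ι) := (a ×ˢ c) ∪ (c ×ˢ a)
  have e₁ : ∀ s, interactionSum h Finset.univ s = interactionSum h ((a ∪ b) ×ˢ (a ∪ b)) s +
      interactionSum h (c ×ˢ c) s + interactionSum h SK s + interactionSum h SV s := by
    intro s
    rw [← interactionSum_union, ← interactionSum_union, ← interactionSum_union]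
    · congr 1
      ext p
      have h1 := hcover p.1
      have h2 := hcover p.2
      simp only [SK, SV, Finset.mem_union, Finset.mem_product, Finset.mem_univ, true_iff]
      tauto
    · rw [Finset.disjoint_left]
      intro p
      simp only [SK, SV, Finset.mem_union, Finset.mem_product]
      grind
    · rw [Finset.disjoint_left]
      intro p
      simp only [SK, Finset.mem_union, Finset.mem_product]
      grind
    · rw [Finset.disjoint_left]
      intro p
      simp only [Finset.mem_union, Finset.mem_product]
      grind
  have e₂ : ∀ s, interactionSum h ((b ∪ c) ×ˢ (b ∪ c)) s = interactionSum h (b ×ˢ b) s +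
      interactionSum h (c ×ˢ c) s + interactionSum h SK s := by
    intro s
    rw [← interactionSum_union, ← interactionSum_union]
    · congr 1
      ext p
      simp only [SK, Finset.mem_union, Finset.mem_product]
      tauto
    · rw [Finset.disjoint_left]
      intro p
      simp only [SK, Finset.mem_union, Finset.mem_product]
      grind
    · rw [Finset.disjoint_left]
      intro p
      simp only [Finset.mem_product]
      grind
  have hR := hU₁.isPrimitive_mul_star hU₂ (sa _)
  -- The difference is driven by the full Hamiltonian. Its source contains [H_bc,R] without the bb
  -- part, and the cc part of this commutator vanishes by `hccR`, leaving the commutator with `SK`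
  -- and the norm of `SV`.
  have hY := hU.isPrimitive.sub (hR.mul hU₃.isPrimitive)
  have hRu : ∀ s, 0 ≤ s → U₁ s * star (U₂ s) ∈ unitary A := fun s hs =>
    mul_mem (hU₁.mem_unitary hs) (hU₂.star_mem_unitary hs)
  have hccR : ∀ s, 0 ≤ s → interactionSum h (c ×ˢ c) s * (U₁ s * star (U₂ s)) =
      (U₁ s * star (U₂ s)) * interactionSum h (c ×ˢ c) s := by
    intro s hs
    have st : ∀ {H V : A}, IsSelfAdjoint H → Commute H V → Commute H (star V) :=
      fun {H V} hH hc => by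
        have := hc.star_star
        rwa [hH.star_eq] at this
    have hne : ∀ {S : Finset (ι × ι)} {W : ℝ → A}, IsEvolution (interactionSum h S) W →
        (∀ p ∈ S, p.1 ∉ c ∧ p.2 ∉ c) → Commute (interactionSum h (c ×ˢ c) s) (W s) := by
      intro S W hW hS
      refine hW.commute (sa S) (fun s' => Commute.sum_left _ _ _ fun p hp =>
        Commute.sum_right _ _ _ fun p' hp' => ?_) hs
      obtain ⟨h1, h2⟩ := Finset.mem_product.1 hp
      obtain ⟨h3, h4⟩ := hS p' hp'
      exact hh.commute _ _ _ _ _ _ (fun e => h3 (e ▸ h1)) (fun e => h4 (e ▸ h1))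
        (fun e => h3 (e ▸ h2)) (fun e => h4 (e ▸ h2))
    refine (hne hU₁ fun p hp => ?_).mul_right (st (sa _ _) (hne hU₂ fun p hp => ?_))
    · simp only [Finset.mem_union, Finset.mem_product] at hp
      grind
    · simp only [Finset.mem_product] at hp
      grind
  have hB := IsPrimitive.sum c fun j _ => (expPartialSum_isPrimitive (w := w)
    (g := fun x => if x ∈ a then (1 : ℝ) else 0) (c := 4 * (lam + 1)) n j).add
      (isPrimitive_pow_div_factorial (8 * lam) n)
  refine (IsEvolution.norm_le_of_isPrimitive hU IsEvolution.zero_one (sa _)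
    (Y := fun s => U s - U₁ s * star (U₂ s) * U₃ s)
    (e := fun s => (-Complex.I) • (((interactionSum h SK s * (U₁ s * star (U₂ s)) -
      (U₁ s * star (U₂ s)) * interactionSum h SK s) +
        interactionSum h SV s * (U₁ s * star (U₂ s))) * U₃ s))
    (hY.congr fun s hs => ?_) (by simp [hU.zero, hU₁.zero, hU₂.zero, hU₃.zero]) hB ht
    fun s hs => ?_).trans ?_
  · have hc := hccR s hs
    generalize U₁ s * star (U₂ s) = R at hc ⊢
    rw [← smul_add]
    have : interactionSum h Finset.univ s * U s - ((interactionSum h ((a ∪ b) ×ˢ (a ∪ b)) s * R -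
        R * interactionSum h (b ×ˢ b) s) * U₃ s +
          R * (interactionSum h ((b ∪ c) ×ˢ (b ∪ c)) s * U₃ s)) =
        (interactionSum h Finset.univ s * (U s - R * U₃ s) - (U s - R * U₃ s) * 0 +
          ((interactionSum h SK s * R - R * interactionSum h SK s) +
            interactionSum h SV s * R) * U₃ s) +
          (interactionSum h (c ×ˢ c) s * R - R * interactionSum h (c ×ˢ c) s) * U₃ s := by
      rw [e₁, e₂]
      noncomm_ring
    rw [hc, sub_self, zero_mul, add_zero] at this
    rw [← this]
    simp only [smul_mul_assoc, mul_smul_comm, smul_sub, smul_add, sub_mul, mul_assoc, neg_smul,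
      neg_mul, mul_neg]
  · have hE : (0 : ℝ) ≤ (8 * lam * s) ^ n / n.factorial := by positivity
    have hf := hh.expBound_nonneg a n hs
    rw [norm_smul, norm_neg, Complex.norm_I, one_mul,
      CStarRing.norm_mul_mem_unitary _ (hU₃.mem_unitary hs)]
    have n1 : ‖interactionSum h SK s * (U₁ s * star (U₂ s)) -
        (U₁ s * star (U₂ s)) * interactionSum h SK s‖ ≤ ∑ p ∈ SK, 2 * w p.1 p.2 *
        (expBound w lam a n s p.1 + expBound w lam a n s p.2 +
          (8 * lam * s) ^ n / n.factorial) := by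
      refine (norm_commutator_interactionSum_le _ _ _).trans (Finset.sum_le_sum fun p hp => ?_)
      have hp' : p.1 ≠ p.2 := fun e => by
        simp only [SK, Finset.mem_union, Finset.mem_product, e] at hp
        have := hbc' p.2
        tauto
      refine (hh.norm_commutator_le hab hU₁ hU₂ n s hs p.1 p.2 (h p.1 p.2 s)
        fun k l s' h1 h2 h3 h4 => hh.commute _ _ _ _ _ _ h1 h2 h3 h4).trans ?_
      have := hf p.1
      have := hf p.2
      have := hh.norm_le _ _ s hp'
      gcongr
    have n2 : ‖interactionSum h SV s * (U₁ s * star (U₂ s))‖ ≤ ∑ p ∈ SV, 2 * w p.1 p.2 *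
        (expBound w lam a n s p.1 + expBound w lam a n s p.2 +
          (8 * lam * s) ^ n / n.factorial) := by
      rw [CStarRing.norm_mul_mem_unitary _ (hRu s hs)]
      refine (norm_interactionSum_le _ _).trans (Finset.sum_le_sum fun p hp => ?_)
      have hp' : p.1 ≠ p.2 := fun e => by
        simp only [SV, Finset.mem_union, Finset.mem_product, e] at hp
        have := hac' p.2
        tauto
      have h3 : 1 ≤ expBound w lam a n s p.1 + expBound w lam a n s p.2 +
          (8 * lam * s) ^ n / n.factorial := by
        simp only [SV, Finset.mem_union, Finset.mem_product] at hp
        rcases hp with ⟨h2, -⟩ | ⟨-, h2⟩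
        · linarith [hh.one_le_expBound n hs h2, hf p.2]
        · linarith [hh.one_le_expBound n hs h2, hf p.1]
      have := hh.norm_le _ _ s hp'
      nlinarith [hh.nonneg p.1 p.2]
    have hdis : Disjoint SK SV := by
      rw [Finset.disjoint_left]
      intro p
      simp only [SK, SV, Finset.mem_union, Finset.mem_product]
      grind
    refine (norm_add_le _ _).trans ((add_le_add n1 n2).trans ?_)
    rw [← Finset.sum_union hdis]
    refine (hh.sum_pairs_le _ _ hf _ hE c fun p hp => ?_).trans ?_
    · simp only [SK, SV, Finset.mem_union, Finset.mem_product] at hp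
      tauto
    · rw [Finset.mul_sum]
      refine Finset.sum_le_sum fun j _ => ?_
      have h1 := hh.sum_pair_le a n hs j
      -- Here each summand involves one site, so `4 * lam` would do; adding this term keeps the
      -- remainder in the same form as in the commutator bound.
      have h2 : 0 ≤ lam * ((8 * lam * s) ^ n / n.factorial) := by positivity
      simp only [expBound] at h1 ⊢
      linarith
  · refine sub_le_self _ (Finset.sum_nonneg fun j _ => ?_)
    have := hh.expBound_nonneg a (n + 1) le_rfl j
    simp only [expBound] at this
    have h0 : (0 : ℝ) ≤ (8 * lam * 0) ^ (n + 1) / (n + 1).factorial := by positivity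
    exact add_nonneg this h0

end IsLocalSystem

end Interaction

/-! ### Lattice sums over hop lengths. -/

section Lattice

variable {D : ℕ}

/-- A point of `ℤ^D`, viewed in Euclidean space `ℝ^D`. -/
noncomputable def intEmbed (v : Fin D → ℤ) : EuclideanSpace ℝ (Fin D) :=
  WithLp.toLp 2 (fun k => (v k : ℝ))

theorem intEmbed_sub (v w : Fin D → ℤ) : intEmbed (v - w) = intEmbed v - intEmbed w := by
  ext k; simp [intEmbed]

theorem intEmbed_sum {κ : Type*} (s : Finset κ) (f : κ → Fin D → ℤ) :
    intEmbed (∑ i ∈ s, f i) = ∑ i ∈ s, intEmbed (f i) := by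
  ext k; simp [intEmbed]

theorem abs_le_norm_intEmbed (v : Fin D → ℤ) (k : Fin D) : |(v k : ℝ)| ≤ ‖intEmbed v‖ := by
  simpa [intEmbed] using PiLp.norm_apply_le (intEmbed v) k

/-- The length of a hop by `v`, where staying in place counts as a hop of length `1`. -/
noncomputable def hopLength (v : Fin D → ℤ) : ℝ := max 1 ‖intEmbed v‖

theorem one_le_hopLength (v : Fin D → ℤ) : 1 ≤ hopLength v := le_max_left _ _

theorem card_hopLength_lt_le (V : Finset (Fin D → ℤ)) {M : ℝ} (hM : 0 ≤ M) :
    ((V.filter fun v => hopLength v < M).card : ℝ) ≤ (2 * M + 1) ^ D := by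
  have hsub : (V.filter fun v => hopLength v < M) ⊆
      Fintype.piFinset fun _ : Fin D => Finset.Icc (-⌊M⌋) ⌊M⌋ := by
    intro v hv
    have h1 := (Finset.mem_filter.1 hv).2
    rw [Fintype.mem_piFinset]
    intro k
    have h2 := (abs_le_norm_intEmbed v k).trans ((le_max_right _ _).trans h1.le)
    rw [← Int.cast_abs] at h2
    exact Finset.mem_Icc.2 (abs_le.1 (Int.le_floor.2 h2))
  have h3 := Finset.card_le_card hsub
  have hf : 0 ≤ ⌊M⌋ := Int.floor_nonneg.2 hM
  have h4 : (((⌊M⌋ + 1 - -⌊M⌋).toNat : ℕ) : ℝ) = 2 * ⌊M⌋ + 1 := by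
    have : (((⌊M⌋ + 1 - -⌊M⌋).toNat : ℕ) : ℤ) = 2 * ⌊M⌋ + 1 := by omega
    exact_mod_cast congrArg (fun z : ℤ => (z : ℝ)) this
  calc ((V.filter fun v => hopLength v < M).card : ℝ)
      ≤ ((Fintype.piFinset fun _ : Fin D => Finset.Icc (-⌊M⌋) ⌊M⌋).card : ℝ) := by
        exact_mod_cast h3
    _ = (2 * ⌊M⌋ + 1 : ℝ) ^ D := by
        rw [Fintype.card_piFinset_const, Int.card_Icc]
        push_cast
        rw [h4]
    _ ≤ _ := by
        have := Int.floor_le M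
        have : (0 : ℝ) ≤ ⌊M⌋ := by exact_mod_cast hf
        gcongr

/-- The tails of the lattice sum of `|v|^(-(D + δ))`. -/
theorem exists_sum_hopLength_rpow_le (D : ℕ) {δ : ℝ} (hδ : 0 < δ) :
    ∃ C : ℝ, 1 ≤ C ∧ ∀ (V : Finset (Fin D → ℤ)) (r : ℝ), 0 < r →
      ∑ v ∈ V.filter (fun v => r ≤ hopLength v), hopLength v ^ (-(D + δ)) ≤ C * r ^ (-δ) := by
  set θ : ℝ := 2 ^ (-δ)
  have hθ0 : 0 < θ := Real.rpow_pos_of_pos two_pos _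
  have hθ1 : θ < 1 := Real.rpow_lt_one_of_one_lt_of_neg one_lt_two (by linarith)
  have hC : 1 ≤ (5 : ℝ) ^ D * (1 - θ)⁻¹ := by
    have h1 : (1 : ℝ) ≤ 5 ^ D := one_le_pow₀ (by norm_num)
    have h2 : 1 ≤ (1 - θ)⁻¹ := (one_le_inv₀ (by linarith)).2 (by linarith)
    nlinarith
  -- Dyadic shells: for X = 2^p r ≥ 1 the shell [X, 2X) holds at most (4X+1)^D ≤ (5X)^D points, so
  -- it contributes at most 5^D X^{-δ} = 5^D r^{-δ} θ^p, a geometric series in p.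
  have key : ∀ (V : Finset (Fin D → ℤ)) (r : ℝ), 1 ≤ r → ∀ N : ℕ,
      ∑ v ∈ V.filter (fun v => r ≤ hopLength v ∧ hopLength v < 2 ^ N * r),
        hopLength v ^ (-(D + δ)) ≤ ∑ p ∈ Finset.range N, 5 ^ D * r ^ (-δ) * θ ^ p := by
    intro V r hr N
    induction N with
    | zero =>
      rw [Finset.filter_false_of_mem]
      · simp
      · intro v _; simp
    | succ N ih =>
      rw [Finset.sum_range_succ]
      set X : ℝ := 2 ^ N * r
      have hX : 1 ≤ X := one_le_mul_of_one_le_of_one_le (one_le_pow₀ one_le_two) hr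
      have hX0 : 0 < X := by linarith
      have hsub : V.filter (fun v => r ≤ hopLength v ∧ hopLength v < 2 ^ (N + 1) * r) ⊆
          V.filter (fun v => r ≤ hopLength v ∧ hopLength v < X) ∪
          (V.filter fun v => hopLength v < 2 * X).filter (fun v => X ≤ hopLength v) := by
        intro v hv
        rw [Finset.mem_filter, pow_succ'] at hv
        simp only [Finset.mem_union, Finset.mem_filter]
        rcases lt_or_ge (hopLength v) X with h | h
        · exact Or.inl ⟨hv.1, hv.2.1, h⟩
        · exact Or.inr ⟨⟨hv.1, by rw [← mul_assoc]; exact hv.2.2⟩, h⟩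
      have hnn : ∀ v : Fin D → ℤ, 0 ≤ hopLength v ^ (-(D + δ)) := fun v =>
        Real.rpow_nonneg (zero_le_one.trans (one_le_hopLength v)) _
      refine (Finset.sum_le_sum_of_subset_of_nonneg hsub fun v _ _ => hnn v).trans ?_
      refine (le_add_of_nonneg_right (Finset.sum_nonneg fun v _ => hnn v)).trans
        ((Finset.sum_union_inter (f := fun v => hopLength v ^ (-(D + δ)))).trans_le ?_)
      refine add_le_add ih ?_
      calc ∑ v ∈ (V.filter fun v => hopLength v < 2 * X).filter (fun v => X ≤ hopLength v),
            hopLength v ^ (-(D + δ))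
          ≤ ∑ v ∈ (V.filter fun v => hopLength v < 2 * X).filter (fun v => X ≤ hopLength v),
            X ^ (-(D + δ)) := Finset.sum_le_sum fun v hv =>
              Real.rpow_le_rpow_of_nonpos hX0 (Finset.mem_filter.1 hv).2 (by
                have : (0 : ℝ) ≤ D := D.cast_nonneg
                linarith)
        _ ≤ (2 * (2 * X) + 1) ^ D * X ^ (-(D + δ)) := by
            rw [Finset.sum_const, nsmul_eq_mul]
            gcongr
            refine le_trans ?_ (card_hopLength_lt_le V (by positivity : (0 : ℝ) ≤ 2 * X))
            exact_mod_cast Finset.card_filter_le _ _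
        _ ≤ (5 * X) ^ D * X ^ (-(D + δ)) := by gcongr; linarith
        _ = 5 ^ D * r ^ (-δ) * θ ^ N := by
            rw [mul_pow, neg_add, Real.rpow_add hX0, Real.rpow_neg hX0.le, Real.rpow_natCast]
            have e1 : X ^ (-δ) = r ^ (-δ) * θ ^ N := by
              rw [Real.mul_rpow (by positivity) (by linarith), ← Real.rpow_natCast,
                ← Real.rpow_mul two_pos.le, mul_comm ((N : ℝ)), Real.rpow_mul two_pos.le,
                Real.rpow_natCast, mul_comm]
            rw [e1]
            field_simp
  have key2 : ∀ (V : Finset (Fin D → ℤ)) (r : ℝ), 1 ≤ r →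
      ∑ v ∈ V.filter (fun v => r ≤ hopLength v), hopLength v ^ (-(D + δ)) ≤
        5 ^ D * (1 - θ)⁻¹ * r ^ (-δ) := by
    intro V r hr
    obtain ⟨N, hN⟩ := pow_unbounded_of_one_lt (∑ v ∈ V, hopLength v) (one_lt_two (α := ℝ))
    have e : V.filter (fun v => r ≤ hopLength v) =
        V.filter (fun v => r ≤ hopLength v ∧ hopLength v < 2 ^ N * r) := by
      refine Finset.filter_congr fun v hv => ⟨fun h => ⟨h, ?_⟩, fun h => h.1⟩
      have h1 := Finset.single_le_sum (f := hopLength)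
        (fun v _ => zero_le_one.trans (one_le_hopLength v)) hv
      have h2 : (0 : ℝ) ≤ 2 ^ N := by positivity
      nlinarith
    rw [e]
    refine (key V r hr N).trans ?_
    rw [← Finset.mul_sum]
    have h1 : ∑ p ∈ Finset.range N, θ ^ p ≤ (1 - θ)⁻¹ :=
      ((summable_geometric_of_lt_one hθ0.le hθ1).sum_le_tsum _ fun _ _ => by positivity).trans_eq
        (tsum_geometric_of_lt_one hθ0.le hθ1)
    have h2 : 0 ≤ r ^ (-δ) := Real.rpow_nonneg (by linarith) _
    calc 5 ^ D * r ^ (-δ) * ∑ p ∈ Finset.range N, θ ^ p ≤ 5 ^ D * r ^ (-δ) * (1 - θ)⁻¹ := by gcongr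
      _ = _ := by ring
  refine ⟨_, hC, fun V r hr => ?_⟩
  -- Hop lengths are at least 1, so for r ≤ 1 the tail is the whole sum, while r^{-δ} ≥ 1.
  rcases le_total 1 r with h | h
  · exact key2 V r h
  · have e : V.filter (fun v => r ≤ hopLength v) = V.filter (fun v => 1 ≤ hopLength v) :=
      Finset.filter_congr fun v _ =>
        ⟨fun _ => one_le_hopLength v, fun _ => h.trans (one_le_hopLength v)⟩
    rw [e]
    refine (key2 V 1 le_rfl).trans ?_
    rw [Real.one_rpow]
    gcongr
    exact Real.one_le_rpow_of_pos_of_le_one_of_nonpos hr h (by linarith)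

end Lattice

/-! ### Weights of hop sequences with a large total length. -/

section PathSum

/-- For x, y ≥ 2 one has x + y ≤ xy. The induction also records that the product is at least 2
unless the sum is 0, since the empty product is only 1. -/
theorem sum_le_prod_of_two_le {κ : Type*} (s : Finset κ) (f : κ → ℝ) (hf : ∀ i ∈ s, 2 ≤ f i) :
    ∑ i ∈ s, f i ≤ ∏ i ∈ s, f i := by
  classical
  have : ∑ i ∈ s, f i ≤ ∏ i ∈ s, f i ∧ 1 ≤ ∏ i ∈ s, f i ∧
      (∑ i ∈ s, f i = 0 ∨ 2 ≤ ∏ i ∈ s, f i) := by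
    induction s using Finset.induction_on with
    | empty => simp
    | insert a s ha ih =>
      obtain ⟨h1, h2, h3⟩ := ih fun i hi => hf i (Finset.mem_insert_of_mem hi)
      have h4 := hf a (Finset.mem_insert_self a s)
      rw [Finset.sum_insert ha, Finset.prod_insert ha]
      refine ⟨?_, by nlinarith, Or.inr (by nlinarith)⟩
      rcases h3 with h3 | h3 <;> nlinarith
  exact this.1

/-- A sequence of `n` lengths that are at least `1` and add up to `R ≥ ℓ` has either `n ≥ γ ℓ / 2`
or a product of at least `(1 - γ) ℓ`. -/
theorem indicator_le_exp_add_indicator {n : ℕ} (a : Fin n → ℝ) (ha : ∀ i, 1 ≤ a i) {γ ℓ : ℝ}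
    (hγ0 : 0 < γ) (hγ1 : γ < 1) :
    (if ℓ ≤ ∑ i, a i then (1 : ℝ) else 0) ≤
      Real.exp (2 * n - γ * ℓ) + if (1 - γ) * ℓ ≤ ∏ i, a i then 1 else 0 := by
  split_ifs with h1 h2 h2
  · linarith [Real.exp_pos (2 * n - γ * ℓ)]
  · rw [add_zero]
    refine Real.one_le_exp ?_
    -- If 2n < γℓ, the hops shorter than 2 cover less than γℓ; the others cover more than (1-γ)ℓ,
    -- and for them the sum is at most the product.
    by_contra hcon
    push Not at hcon
    refine h2 ?_
    have e := Finset.sum_filter_add_sum_filter_not Finset.univ (fun i => 2 ≤ a i) a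
    have h3 : ∑ i with ¬ 2 ≤ a i, a i ≤ 2 * n := by
      calc ∑ i with ¬ 2 ≤ a i, a i ≤ ∑ i : Fin n with ¬ 2 ≤ a i, (2 : ℝ) :=
            Finset.sum_le_sum fun i hi => (not_le.1 (Finset.mem_filter.1 hi).2).le
        _ ≤ ∑ i : Fin n, (2 : ℝ) :=
            Finset.sum_le_sum_of_subset_of_nonneg (Finset.filter_subset _ _) (by simp)
        _ = 2 * n := by simp [mul_comm]
    have h4 := sum_le_prod_of_two_le (Finset.univ.filter fun i => 2 ≤ a i) a
      fun i hi => (Finset.mem_filter.1 hi).2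
    have h5 : ∏ i with 2 ≤ a i, a i ≤ ∏ i, a i := by
      rw [← Finset.prod_filter_mul_prod_filter_not Finset.univ (fun i => 2 ≤ a i) a]
      refine le_mul_of_one_le_right
        (Finset.prod_nonneg fun i _ => zero_le_one.trans (ha i)) ?_
      exact Finset.one_le_prod fun i _ => ha i
    nlinarith
  · linarith [Real.exp_pos (2 * n - γ * ℓ)]
  · linarith [Real.exp_pos (2 * n - γ * ℓ)]

variable {V : Type*} [Fintype V] {a : V → ℝ} {α β C lam : ℝ}

/-- The factor ∑|v_i| singles out one hop i, whose length must be at least S divided by the product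
Q of the others. The tail bound for that hop gives C S^{-β} Q^β, so every other hop is left with the
summable weight |v|^{β-α}. With β = α-D-1 this is |v|^{-(D+1)}, independent of α. -/
theorem sum_paths_of_le_prod_le (ha : ∀ v, 1 ≤ a v)
    (htail : ∀ r, 0 < r → ∑ v with r ≤ a v, a v ^ (1 - α) ≤ C * r ^ (-β))
    (hC : 0 ≤ C) (hsum : ∑ v, a v ^ (β - α) ≤ lam) (n : ℕ) {S : ℝ} (hS : 0 < S) :
    ∑ p : Fin n → V, (∑ i, a (p i)) * (∏ i, a (p i) ^ (-α)) *
        (if S ≤ ∏ i, a (p i) then 1 else 0) ≤ C * n * lam ^ (n - 1) * S ^ (-β) := by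
  have ha0 : ∀ v, 0 < a v := fun v => zero_lt_one.trans_le (ha v)
  simp only [Finset.sum_mul]
  rw [Finset.sum_comm]
  have key : ∀ i : Fin n, ∑ p : Fin n → V, a (p i) * (∏ j, a (p j) ^ (-α)) *
      (if S ≤ ∏ j, a (p j) then 1 else 0) ≤ C * lam ^ (n - 1) * S ^ (-β) := by
    intro i
    obtain ⟨m, rfl⟩ := Nat.exists_eq_succ_of_ne_zero (Nat.pos_iff_ne_zero.1 i.pos)
    rw [← (Fin.insertNthEquiv (fun _ => V) i).sum_comp, Fintype.sum_prod_type_right]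
    simp only [Fin.insertNthEquiv_apply, Fin.prod_univ_succAbove _ i, Fin.insertNth_apply_same,
      Fin.insertNth_apply_succAbove]
    have hin : ∀ q : Fin m → V, ∑ v, a v * (a v ^ (-α) * ∏ j, a (q j) ^ (-α)) *
        (if S ≤ a v * ∏ j, a (q j) then 1 else 0) ≤
        C * S ^ (-β) * ∏ j, a (q j) ^ (β - α) := by
      intro q
      have hQ : 0 < ∏ j, a (q j) := Finset.prod_pos fun j _ => ha0 _
      have e1 : ∀ s : ℝ, ∏ j, a (q j) ^ s = (∏ j, a (q j)) ^ s := fun s =>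
        Real.finsetProd_rpow _ _ (fun j _ => (ha0 _).le) s
      calc ∑ v, a v * (a v ^ (-α) * ∏ j, a (q j) ^ (-α)) *
            (if S ≤ a v * ∏ j, a (q j) then 1 else 0)
          = (∏ j, a (q j)) ^ (-α) * ∑ v with S / (∏ j, a (q j)) ≤ a v, a v ^ (1 - α) := by
            rw [Finset.sum_filter, Finset.mul_sum]
            refine Finset.sum_congr rfl fun v _ => ?_
            simp only [e1, div_le_iff₀ hQ, sub_eq_add_neg, Real.rpow_add (ha0 v), Real.rpow_one]
            split_ifs <;> ring
        _ ≤ (∏ j, a (q j)) ^ (-α) * (C * (S / (∏ j, a (q j))) ^ (-β)) := by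
            gcongr
            exact htail _ (by positivity)
        _ = C * S ^ (-β) * ∏ j, a (q j) ^ (β - α) := by
            rw [e1, Real.div_rpow hS.le hQ.le, Real.rpow_neg hQ.le β, div_inv_eq_mul,
              sub_eq_add_neg, Real.rpow_add hQ]
            ring
    refine (Finset.sum_le_sum fun q _ => hin q).trans ?_
    rw [← Finset.mul_sum, ← Fintype.sum_pow (fun v => a v ^ (β - α)) m]
    have h0 : 0 ≤ ∑ v, a v ^ (β - α) :=
        Finset.sum_nonneg fun v _ => (Real.rpow_pos_of_pos (ha0 v) _).le
    have h1 : (∑ v, a v ^ (β - α)) ^ m ≤ lam ^ m := pow_le_pow_left₀ h0 hsum m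
    have h2 : 0 ≤ S ^ (-β) := by positivity
    calc C * S ^ (-β) * (∑ v, a v ^ (β - α)) ^ m ≤ C * S ^ (-β) * lam ^ m := by gcongr
      _ = _ := by simp; ring
  refine (Finset.sum_le_sum fun i _ => key i).trans_eq ?_
  simp
  ring

theorem sum_paths_of_le_sum_le (ha : ∀ v, 1 ≤ a v)
    (htail : ∀ r, 0 < r → ∑ v with r ≤ a v, a v ^ (1 - α) ≤ C * r ^ (-β))
    (hC : 0 ≤ C) (hsum : ∑ v, a v ^ (β - α) ≤ lam) (n : ℕ) {γ ℓ : ℝ} (hγ0 : 0 < γ) (hγ1 : γ < 1)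
    (hℓ : 0 < ℓ) :
    ∑ p : Fin n → V, (∑ i, a (p i)) * (∏ i, a (p i) ^ (-α)) *
        (if ℓ ≤ ∑ i, a (p i) then 1 else 0) ≤
      C * n * lam ^ (n - 1) * (Real.exp (2 * n - γ * ℓ) + ((1 - γ) * ℓ) ^ (-β)) := by
  have ha0 : ∀ v, 0 < a v := fun v => zero_lt_one.trans_le (ha v)
  -- The threshold 1 is always met, so this bounds the unrestricted sum; it is used with the
  -- exponential factor.
  have h1 := sum_paths_of_le_prod_le ha htail hC hsum n zero_lt_one
  have h2 := sum_paths_of_le_prod_le ha htail hC hsum n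
    (mul_pos (by linarith : 0 < 1 - γ) hℓ)
  have hpos : ∀ p : Fin n → V, 0 ≤ (∑ i, a (p i)) * ∏ i, a (p i) ^ (-α) := fun p =>
    mul_nonneg (Finset.sum_nonneg fun i _ => (ha0 _).le)
      (Finset.prod_nonneg fun i _ => (Real.rpow_pos_of_pos (ha0 _) _).le)
  have h3 : ∀ p : Fin n → V, (∑ i, a (p i)) * (∏ i, a (p i) ^ (-α)) *
      (if ℓ ≤ ∑ i, a (p i) then 1 else 0) ≤
      Real.exp (2 * n - γ * ℓ) * ((∑ i, a (p i)) * (∏ i, a (p i) ^ (-α)) *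
        (if 1 ≤ ∏ i, a (p i) then 1 else 0)) + (∑ i, a (p i)) * (∏ i, a (p i) ^ (-α)) *
        (if (1 - γ) * ℓ ≤ ∏ i, a (p i) then 1 else 0) := fun p => by
    rw [if_pos (Finset.one_le_prod fun i _ => ha _), mul_one, mul_comm (Real.exp _), ← mul_add]
    exact mul_le_mul_of_nonneg_left
      (indicator_le_exp_add_indicator (fun i => a (p i)) (fun i => ha _) hγ0 hγ1) (hpos p)
  refine (Finset.sum_le_sum fun p _ => h3 p).trans ?_
  rw [Finset.sum_add_distrib, ← Finset.mul_sum]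
  rw [Real.one_rpow, mul_one] at h1
  nlinarith [mul_le_mul_of_nonneg_left h1 (Real.exp_pos (2 * n - γ * ℓ)).le]

end PathSum

/-! ### From iterated kernels to free hop sequences. -/

section KernelPaths

variable {D : ℕ} {ι : Type*} [Fintype ι] {pos : ι → Fin D → ℤ}

/-- The kernel is translation invariant, so paths are described by their hops. Intermediate points
are no longer required to be sites, and nonnegativity makes this an upper bound. -/
theorem kernelIter_le_sum_paths (hpos : Function.Injective pos) {V : Finset (Fin D → ℤ)}
    (hV : ∀ x z, pos x - pos z ∈ V) {f : (Fin D → ℤ) → ℝ} (hf : ∀ v, 0 ≤ f v)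
    {χ : (Fin D → ℤ) → ℝ} (hχ : ∀ v, 0 ≤ χ v) {w : ι → ι → ℝ}
    (hw : ∀ x z, w x z = f (pos x - pos z)) (m : ℕ) : ∀ x,
    kernelIter w (fun x => χ (pos x)) m x ≤
      ∑ p : Fin m → V, (∏ i, f (p i)) * χ (pos x - ∑ i, (p i : Fin D → ℤ)) := by
  induction m with
  | zero => intro x; simp [kernelIter]
  | succ m ih =>
    intro x
    set F : V → ℝ := fun v => f v * ∑ p : Fin m → V, (∏ i, f (p i)) *
      χ (pos x - v - ∑ i, (p i : Fin D → ℤ))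
    have hF : ∀ v, 0 ≤ F v := fun v => mul_nonneg (hf _) (Finset.sum_nonneg fun p _ =>
      mul_nonneg (Finset.prod_nonneg fun i _ => hf _) (hχ _))
    have hinj : Function.Injective fun z => (⟨pos x - pos z, hV x z⟩ : V) := fun z z' h => by
      have := congrArg Subtype.val h
      exact hpos (sub_right_injective this)
    calc kernelIter w (fun x => χ (pos x)) (m + 1) x
        ≤ ∑ z, F ⟨pos x - pos z, hV x z⟩ := by
          simp only [kernelIter]
          refine Finset.sum_le_sum fun z _ => ?_
          rw [hw]
          refine mul_le_mul_of_nonneg_left ((ih z).trans_eq ?_) (hf _)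
          simp
      _ = ∑ v ∈ Finset.univ.map ⟨_, hinj⟩, F v := by rw [Finset.sum_map]; rfl
      _ ≤ ∑ v, F v :=
          Finset.sum_le_sum_of_subset_of_nonneg (Finset.subset_univ _) fun v _ _ => hF v
      _ = _ := by
          rw [← (Fin.consEquiv fun _ : Fin (m + 1) => (V : Type _)).sum_comp,
            Fintype.sum_prod_type]
          refine Finset.sum_congr rfl fun v _ => ?_
          simp only [F, Finset.mul_sum]
          refine Finset.sum_congr rfl fun p _ => ?_
          simp [Fin.consEquiv, Fin.prod_univ_succ, Fin.sum_univ_succ, mul_assoc, sub_sub]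

/-- The total weight of the paths of `m` hops leading from `a` to `c`, if the number of points of
`a` that are translated into `c` is subadditive in the translation vector. -/
theorem sum_kernelIter_le [DecidableEq ι] (hpos : Function.Injective pos) {α β C lam b γ ℓ : ℝ}
    (htail : ∀ (V : Finset (Fin D → ℤ)) (r : ℝ), 0 < r →
      ∑ v ∈ V.filter (fun v => r ≤ hopLength v), hopLength v ^ (1 - α) ≤ C * r ^ (-β))
    (hC : 0 ≤ C)
    (hsum : ∀ V : Finset (Fin D → ℤ), ∑ v ∈ V, hopLength v ^ (β - α) ≤ lam)
    (hγ0 : 0 < γ) (hγ1 : γ < 1) (hℓ : 0 < ℓ) (a c : Finset ι)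
    (hac : ∀ i ∈ a, ∀ j ∈ c, ℓ ≤ ‖intEmbed (pos j - pos i)‖) {N : (Fin D → ℤ) → ℝ}
    (hN : ∀ x, ((c.filter fun j => ∃ i ∈ a, pos i = pos j - x).card : ℝ) ≤ N x)
    (hN0 : N 0 ≤ 0) (hNadd : ∀ x y, N (x + y) ≤ N x + N y) (hb : 0 ≤ b)
    (hNle : ∀ x, N x ≤ b * hopLength x)
    (m : ℕ) :
    ∑ j ∈ c, kernelIter (fun x z => hopLength (pos x - pos z) ^ (-α))
      (fun x => if x ∈ a then (1 : ℝ) else 0) m j ≤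
      b * (C * m * lam ^ (m - 1) * (Real.exp (2 * m - γ * ℓ) + ((1 - γ) * ℓ) ^ (-β))) := by
  classical
  set V : Finset (Fin D → ℤ) := Finset.univ.image fun q : ι × ι => pos q.1 - pos q.2
  set χ : (Fin D → ℤ) → ℝ := fun v => if ∃ i ∈ a, pos i = v then 1 else 0
  have hχ : ∀ v, 0 ≤ χ v := fun v => by simp only [χ]; split_ifs <;> norm_num
  have hf : ∀ v : Fin D → ℤ, 0 ≤ hopLength v ^ (-α) := fun v =>
    Real.rpow_nonneg (zero_le_one.trans (one_le_hopLength v)) _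
  have hχa : (fun x => if x ∈ a then (1 : ℝ) else 0) = fun x => χ (pos x) := by
    ext x
    simp only [χ, hpos.eq_iff, exists_eq_right]
  rw [hχa]
  have h1 : ∀ j, _ := kernelIter_le_sum_paths hpos (V := V)
    (fun x z => Finset.mem_image.2 ⟨(x, z), Finset.mem_univ _, rfl⟩) hf hχ
    (w := fun x z => hopLength (pos x - pos z) ^ (-α)) (fun _ _ => rfl) m
  refine (Finset.sum_le_sum fun j _ => h1 j).trans ?_
  rw [Finset.sum_comm]
  have hNsum : ∀ {κ : Type} (s : Finset κ) (f : κ → Fin D → ℤ),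
      N (∑ i ∈ s, f i) ≤ ∑ i ∈ s, N (f i) := by
    intro κ s f
    induction s using Finset.induction_on with
    | empty => simpa using hN0
    | insert i s hi ih =>
      rw [Finset.sum_insert hi, Finset.sum_insert hi]
      exact (hNadd _ _).trans (add_le_add_right ih _)
  -- For fixed hops the sum over endpoints counts the points of `c` that are translates of points of
  -- `a`. It is empty unless the hops cover ℓ, and is otherwise at most `b` times their total length
  -- by subadditivity of `N`.
  have h2 : ∀ p : Fin m → V, ∑ j ∈ c, (∏ i, hopLength (p i : Fin D → ℤ) ^ (-α)) *
      χ (pos j - ∑ i, (p i : Fin D → ℤ)) ≤ b * ((∑ i, hopLength (p i : Fin D → ℤ)) *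
        (∏ i, hopLength (p i : Fin D → ℤ) ^ (-α)) *
          (if ℓ ≤ ∑ i, hopLength (p i : Fin D → ℤ) then 1 else 0)) := by
    intro p
    have hprod : 0 ≤ ∏ i, hopLength (p i : Fin D → ℤ) ^ (-α) :=
      Finset.prod_nonneg fun i _ => hf _
    have hR : 0 ≤ ∑ i, hopLength (p i : Fin D → ℤ) :=
      Finset.sum_nonneg fun i _ => zero_le_one.trans (one_le_hopLength _)
    rw [← Finset.mul_sum]
    by_cases hex : ∃ j ∈ c, ∃ i ∈ a, pos i = pos j - ∑ i, (p i : Fin D → ℤ)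
    · obtain ⟨j, hj, i, hi, hij⟩ := hex
      have h3 : ℓ ≤ ∑ i, hopLength (p i : Fin D → ℤ) := by
        refine (hac i hi j hj).trans ?_
        rw [hij, sub_sub_cancel, intEmbed_sum]
        exact (norm_sum_le _ _).trans (Finset.sum_le_sum fun i _ => le_max_right _ _)
      rw [if_pos h3, mul_one]
      have h4 : ∑ j ∈ c, χ (pos j - ∑ i, (p i : Fin D → ℤ)) ≤
          b * ∑ i, hopLength (p i : Fin D → ℤ) := by
        simp only [χ]
        rw [Finset.sum_boole]
        refine (hN _).trans ((hNsum _ _).trans ?_)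
        rw [Finset.mul_sum]
        exact Finset.sum_le_sum fun i _ => hNle _
      calc _ ≤ (∏ i, hopLength (p i : Fin D → ℤ) ^ (-α)) *
          (b * ∑ i, hopLength (p i : Fin D → ℤ)) := mul_le_mul_of_nonneg_left h4 hprod
        _ = _ := by ring
    · have h3 : ∑ j ∈ c, χ (pos j - ∑ i, (p i : Fin D → ℤ)) = 0 :=
        Finset.sum_eq_zero fun j hj => if_neg fun h => hex ⟨j, hj, h⟩
      rw [h3, mul_zero]
      split_ifs <;> positivity
  refine (Finset.sum_le_sum fun p _ => h2 p).trans ?_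
  rw [← Finset.mul_sum]
  refine mul_le_mul_of_nonneg_left (sum_paths_of_le_sum_le (V := V)
    (a := fun v => hopLength (v : Fin D → ℤ)) (fun v => one_le_hopLength _) (fun r hr => ?_) hC ?_ m
    hγ0 hγ1 hℓ) hb
  · refine le_trans (le_of_eq ?_) (htail V r hr)
    rw [Finset.sum_filter, Finset.sum_filter]
    exact Finset.sum_coe_sort V fun v => if r ≤ hopLength v then hopLength v ^ (1 - α) else 0
  · exact (Finset.sum_coe_sort V fun v => hopLength v ^ (β - α)).trans_le (hsum V)

end KernelPaths

/-! ### Nearest-point projection and supporting hyperplanes of convex sets. -/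

section Projection

open scoped RealInnerProductSpace

variable {E : Type*} [NormedAddCommGroup E] [InnerProductSpace ℝ E]

/-- Adding the two obtuse-angle conditions gives ‖p-q‖² ≤ ⟪u-v, p-q⟫; Cauchy–Schwarz finishes. -/
theorem norm_sub_le_of_inner_le_zero {u v p q : E} (hp : ⟪u - p, q - p⟫ ≤ 0)
    (hq : ⟪v - q, p - q⟫ ≤ 0) : ‖p - q‖ ≤ ‖u - v‖ := by
  have h1 : ⟪p - q, p - q⟫ ≤ ⟪u - v, p - q⟫ := by
    have e1 : ⟪u - p, q - p⟫ = - ⟪u - p, p - q⟫ := by rw [← neg_sub p q, inner_neg_right]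
    have e2 : u - v = (u - p) + (p - q) - (v - q) := by abel
    rw [e2, inner_sub_left (u - p + (p - q)), inner_add_left]
    linarith
  rw [real_inner_self_eq_norm_sq] at h1
  have h2 := h1.trans (real_inner_le_norm _ _)
  by_contra h
  push Not at h
  nlinarith [norm_nonneg (u - v)]

/-- The nearest-point map onto a closed convex set, characterised by the obtuse angle criterion. -/
theorem exists_projection [CompleteSpace E] {A : Set E} (hne : A.Nonempty) (hcl : IsClosed A)
    (hconv : Convex ℝ A) : ∃ P : E → E, LipschitzWith 1 P ∧
      ∀ z, ∀ x ∈ A, (∀ y ∈ A, ⟪z - x, y - x⟫ ≤ 0) → P z = x := by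
  choose P hPA hP using exists_norm_eq_iInf_of_complete_convex hne hcl.isComplete hconv
  have hP' : ∀ z, ∀ y ∈ A, ⟪z - P z, y - P z⟫ ≤ 0 := fun z =>
    (norm_eq_iInf_iff_real_inner_le_zero hconv (hPA z)).1 (hP z)
  refine ⟨P, LipschitzWith.of_dist_le_mul fun u v => ?_, fun z x hx h => ?_⟩
  · rw [NNReal.coe_one, one_mul, dist_eq_norm, dist_eq_norm]
    exact norm_sub_le_of_inner_le_zero (hP' u _ (hPA v)) (hP' v _ (hPA u))
  · have := norm_sub_le_of_inner_le_zero (hP' z x hx) (h _ (hPA z))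
    rwa [sub_self, norm_zero, norm_le_zero_iff, sub_eq_zero] at this

theorem exists_supporting_direction [CompleteSpace E] {A : Set E} (hconv : Convex ℝ A)
    (hint : (interior A).Nonempty) {x : E} (hx : x ∉ interior A) :
    ∃ u : E, u ≠ 0 ∧ ∀ y ∈ A, ⟪u, y - x⟫ ≤ 0 := by
  obtain ⟨f, hf⟩ := geometric_hahn_banach_open_point hconv.interior isOpen_interior hx
  set u := (InnerProductSpace.toDual ℝ E).symm f
  have hu : ∀ y, ⟪u, y⟫ = f y := fun y => InnerProductSpace.toDual_symm_apply
  refine ⟨u, fun h0 => ?_, fun y hy => ?_⟩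
  · obtain ⟨z, hz⟩ := hint
    have := hf z hz
    rw [← hu, ← hu, h0, inner_zero_left, inner_zero_left] at this
    exact lt_irrefl _ this
  · have hyc : y ∈ closure (interior A) := by
      rw [hconv.closure_interior_eq_closure_of_nonempty_interior hint]
      exact subset_closure hy
    have hcl : IsClosed {y | f y ≤ f x} := isClosed_le f.continuous continuous_const
    have : y ∈ {y | f y ≤ f x} := closure_minimal (fun z hz => (hf z hz).le) hcl hyc
    rw [inner_sub_right, hu, hu]
    exact sub_nonpos.2 this

end Projection

/-! ### Coordinate projections and shadows. -/

section Coordinates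

variable {d : ℕ}

/-- The orthogonal projection of `ℝ^(d+1)` along the `i`-th coordinate axis. -/
noncomputable def dropCoord (i : Fin (d + 1)) (x : EuclideanSpace ℝ (Fin (d + 1))) :
    EuclideanSpace ℝ (Fin d) :=
  WithLp.toLp 2 fun k => x (i.succAbove k)

/-- The hyperplane inclusion of `ℝ^d` into `ℝ^(d+1)` with `i`-th coordinate `c`. -/
noncomputable def insertCoord (i : Fin (d + 1)) (c : ℝ) (y : EuclideanSpace ℝ (Fin d)) :
    EuclideanSpace ℝ (Fin (d + 1)) :=
  WithLp.toLp 2 (i.insertNth c y.ofLp)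

theorem insertCoord_dropCoord (i : Fin (d + 1)) (x : EuclideanSpace ℝ (Fin (d + 1))) :
    insertCoord i (x i) (dropCoord i x) = x := by
  ext k
  rcases Fin.eq_self_or_eq_succAbove i k with rfl | ⟨j, rfl⟩ <;> simp [insertCoord, dropCoord]

theorem dropCoord_insertCoord (i : Fin (d + 1)) (c : ℝ) (y : EuclideanSpace ℝ (Fin d)) :
    dropCoord i (insertCoord i c y) = y := by
  ext k
  simp [insertCoord, dropCoord]

theorem dist_sq_eq_add_dist_dropCoord_sq (i : Fin (d + 1))
    (x y : EuclideanSpace ℝ (Fin (d + 1))) :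
    dist x y ^ 2 = (x i - y i) ^ 2 + dist (dropCoord i x) (dropCoord i y) ^ 2 := by
  rw [EuclideanSpace.dist_eq, EuclideanSpace.dist_eq, Real.sq_sqrt (by positivity),
    Real.sq_sqrt (by positivity), Fin.sum_univ_succAbove _ i]
  simp [dropCoord, Real.dist_eq, sq_abs]

theorem lipschitzWith_dropCoord (i : Fin (d + 1)) : LipschitzWith 1 (dropCoord i) :=
  LipschitzWith.of_dist_le_mul fun x y => by
    have := dist_sq_eq_add_dist_dropCoord_sq i x y
    rw [NNReal.coe_one, one_mul]
    exact abs_le_of_sq_le_sq' (by nlinarith [sq_nonneg (x i - y i)]) dist_nonneg |>.2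

theorem isometry_insertCoord (i : Fin (d + 1)) (c : ℝ) : Isometry (insertCoord i c) :=
  Isometry.of_dist_eq fun x y => by
    have := dist_sq_eq_add_dist_dropCoord_sq i (insertCoord i c x) (insertCoord i c y)
    rw [dropCoord_insertCoord, dropCoord_insertCoord] at this
    have e : insertCoord i c x i - insertCoord i c y i = 0 := by simp [insertCoord]
    rw [e, zero_pow two_ne_zero, zero_add] at this
    exact (sq_eq_sq₀ dist_nonneg dist_nonneg).1 this

theorem dropCoord_add (i : Fin (d + 1)) (x y : EuclideanSpace ℝ (Fin (d + 1))) :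
    dropCoord i (x + y) = dropCoord i x + dropCoord i y := by
  ext k; simp [dropCoord]

theorem dropCoord_smul (i : Fin (d + 1)) (c : ℝ) (x : EuclideanSpace ℝ (Fin (d + 1))) :
    dropCoord i (c • x) = c • dropCoord i x := by
  ext k; simp [dropCoord]

theorem convex_image_dropCoord (i : Fin (d + 1)) {A : Set (EuclideanSpace ℝ (Fin (d + 1)))}
    (hA : Convex ℝ A) : Convex ℝ (dropCoord i '' A) := by
  rintro _ ⟨x, hx, rfl⟩ _ ⟨y, hy, rfl⟩ a b ha hb hab
  exact ⟨a • x + b • y, hA hx hy ha hb hab, by simp only [dropCoord_add, dropCoord_smul]⟩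

theorem closedBall_subset_image_dropCoord (i : Fin (d + 1))
    {A : Set (EuclideanSpace ℝ (Fin (d + 1)))} {x : EuclideanSpace ℝ (Fin (d + 1))} {ρ : ℝ}
    (h : Metric.closedBall x ρ ⊆ A) :
    Metric.closedBall (dropCoord i x) ρ ⊆ dropCoord i '' A := by
  intro y hy
  refine ⟨insertCoord i (x i) y, h ?_, dropCoord_insertCoord _ _ _⟩
  have := dist_sq_eq_add_dist_dropCoord_sq i (insertCoord i (x i) y) x
  rw [dropCoord_insertCoord] at this
  have e : insertCoord i (x i) y i - x i = 0 := by simp [insertCoord]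
  rw [e, zero_pow two_ne_zero, zero_add] at this
  rw [Metric.mem_closedBall, (sq_eq_sq₀ dist_nonneg dist_nonneg).1 this]
  exact hy

/-- A line in direction i that meets the bounded set A also leaves it, hence crosses its frontier.
The shadow of A is therefore a 1-Lipschitz image of part of the frontier. -/
theorem image_dropCoord_subset (i : Fin (d + 1)) {A : Set (EuclideanSpace ℝ (Fin (d + 1)))}
    (hA : Bornology.IsBounded A) : dropCoord i '' A ⊆ dropCoord i '' frontier A := by
  rintro _ ⟨x, hx, rfl⟩
  set g : ℝ → EuclideanSpace ℝ (Fin (d + 1)) := fun s => insertCoord i s (dropCoord i x)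
  have hg : Continuous g := by
    refine (PiLp.continuous_toLp 2 _).comp ?_
    exact Continuous.finInsertNth i continuous_id continuous_const
  have hne : (frontier (g ⁻¹' A)).Nonempty := by
    rw [nonempty_frontier_iff]
    refine ⟨⟨x i, by simpa [g, insertCoord_dropCoord] using hx⟩, fun hu => ?_⟩
    obtain ⟨M, hM⟩ := hA.exists_norm_le
    have h1 : g (|M| + 1) ∈ A := by
      have : |M| + 1 ∈ g ⁻¹' A := hu ▸ Set.mem_univ _
      exact this
    have h2 := (PiLp.norm_apply_le (g (|M| + 1)) i).trans (hM _ h1)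
    have h3 : g (|M| + 1) i = |M| + 1 := by simp [g, insertCoord]
    rw [h3, Real.norm_eq_abs, abs_of_nonneg (by positivity)] at h2
    linarith [le_abs_self M]
  obtain ⟨s, hs⟩ := hne
  exact ⟨g s, hg.frontier_preimage_subset A hs, dropCoord_insertCoord _ _ _⟩

end Coordinates

/-! ### Boundary area: lower bound by shadows, and finiteness. -/

section Area

variable {d : ℕ}

theorem euclideanHausdorffMeasure_image_le {X Y : Type*} [EMetricSpace X] [MeasurableSpace X]
    [BorelSpace X] [EMetricSpace Y] [MeasurableSpace Y] [BorelSpace Y] {f : X → Y}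
    (hf : LipschitzWith 1 f) (d : ℕ) (s : Set X) :
    Measure.euclideanHausdorffMeasure d (f '' s) ≤ Measure.euclideanHausdorffMeasure d s := by
  simp_rw [Measure.euclideanHausdorffMeasure_def, Measure.smul_apply]
  have := hf.hausdorffMeasure_image_le (d := d) d.cast_nonneg s
  rw [ENNReal.coe_one, ENNReal.one_rpow, one_mul] at this
  gcongr

theorem volume_image_dropCoord_le (i : Fin (d + 1)) {A : Set (EuclideanSpace ℝ (Fin (d + 1)))}
    (hA : Bornology.IsBounded A) :
    volume (dropCoord i '' A) ≤ Measure.euclideanHausdorffMeasure d (frontier A) := by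
  rw [← EuclideanSpace.euclideanHausdorffMeasure_eq_volume]
  exact (measure_mono (image_dropCoord_subset i hA)).trans
    (euclideanHausdorffMeasure_image_le (lipschitzWith_dropCoord i) d _)

/-- The boundary of a convex body has finite area: it is the image under the nearest-point map of
finitely many flat disks. -/
theorem euclideanHausdorffMeasure_frontier_lt_top {A : Set (EuclideanSpace ℝ (Fin (d + 1)))}
    (hA : IsCompact A) (hconv : Convex ℝ A) (hint : (interior A).Nonempty) :
    Measure.euclideanHausdorffMeasure d (frontier A) < ⊤ := by
  obtain ⟨P, hPlip, hP⟩ := exists_projection (hint.mono interior_subset) hA.isClosed hconv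
  obtain ⟨M, hM⟩ := hA.isBounded.exists_norm_le
  set r : ℝ := √((d + 1) * (3 * M) ^ 2)
  have hsub : frontier A ⊆ ⋃ q : Fin (d + 1) × Bool, P '' (insertCoord q.1
      (if q.2 then M else -M) '' Metric.closedBall (0 : EuclideanSpace ℝ (Fin d)) r) := by
    intro x hx
    rw [hA.isClosed.frontier_eq] at hx
    obtain ⟨u, hu0, hu⟩ := exists_supporting_direction hconv hint hx.2
    obtain ⟨k, -, hk⟩ := Finset.exists_max_image Finset.univ (fun k => |u k|)
      ⟨0, Finset.mem_univ _⟩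
    have huk : u k ≠ 0 := fun h0 => hu0 (by
      ext j
      have := hk j (Finset.mem_univ _)
      rw [h0, abs_zero] at this
      simpa using this)
    have hxM : ∀ j, |x j| ≤ M := fun j =>
      (PiLp.norm_apply_le x j).trans (hM x hx.1)
    have huk' : 0 < |u k| := abs_pos.2 huk
    have hkx := abs_le.1 (hxM k)
    obtain ⟨σ, hσ⟩ : ∃ σ : Bool, (if σ then (1 : ℝ) else -1) * u k = |u k| := by
      rcases lt_or_gt_of_ne huk with h | h
      · exact ⟨false, by simp [abs_of_neg h]⟩
      · exact ⟨true, by simp [abs_of_pos h]⟩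
    set ε : ℝ := if σ then 1 else -1
    have hε : ε = 1 ∨ ε = -1 := by simp only [ε]; split_ifs <;> simp
    have hε2 : ε * ε = 1 := by rcases hε with h | h <;> rw [h] <;> norm_num
    -- From x, go along the outward normal `u` until the coordinate `k` with the largest |u k|
    -- reaches ±M. This takes s|u k| ≤ 2M, so no coordinate of the endpoint exceeds 3M, and the
    -- nearest-point map sends the endpoint back to x.
    set s : ℝ := (M - ε * x k) / |u k|
    have hs1 : s * |u k| = M - ε * x k := div_mul_cancel₀ _ huk'.ne'
    have hs0 : 0 ≤ s := div_nonneg (by rcases hε with h | h <;> rw [h] <;> linarith) huk'.le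
    set z := x + s • u
    have hzk : z k = ε * M := by
      have : u k = ε * |u k| := by rw [← hσ, ← mul_assoc, hε2, one_mul]
      calc z k = x k + s * u k := by simp [z]
        _ = x k + ε * (s * |u k|) := by rw [mul_left_comm, ← this]
        _ = ε * M + (1 - ε * ε) * x k := by rw [hs1]; ring
        _ = ε * M := by rw [hε2]; ring
    have hzj : ∀ j, |z j| ≤ 3 * M := fun j => by
      have h1 : |z j| ≤ |x j| + s * |u j| := by
        calc |z j| = |x j + s * u j| := by simp [z]
          _ ≤ |x j| + |s * u j| := abs_add_le _ _
          _ = _ := by rw [abs_mul, abs_of_nonneg hs0]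
      have h2 := mul_le_mul_of_nonneg_left (hk j (Finset.mem_univ _)) hs0
      have h3 : M - ε * x k ≤ 2 * M := by rcases hε with h | h <;> rw [h] <;> linarith
      linarith [hxM j]
    have hPz : P z = x := hP z x hx.1 fun y hy => by
      simp only [z, add_sub_cancel_left, inner_smul_left]
      exact mul_nonpos_of_nonneg_of_nonpos hs0 (hu y hy)
    refine Set.mem_iUnion.2 ⟨(k, σ), z, ⟨dropCoord k z, ?_, ?_⟩, hPz⟩
    · rw [mem_closedBall_zero_iff]
      have h1 := (lipschitzWith_dropCoord k).dist_le_mul z 0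
      rw [show dropCoord k (0 : EuclideanSpace ℝ (Fin (d + 1))) = 0 from by ext; simp [dropCoord],
        dist_zero_right, dist_zero_right, NNReal.coe_one, one_mul] at h1
      refine h1.trans ?_
      rw [EuclideanSpace.norm_eq]
      refine Real.sqrt_le_sqrt ?_
      calc ∑ j, ‖z j‖ ^ 2 ≤ ∑ j : Fin (d + 1), (3 * M) ^ 2 := by
            gcongr with j
            exact hzj j
        _ = _ := by simp
    · have : (if σ then M else -M) = z k := by
        rw [hzk]; simp only [ε]; split_ifs <;> ring
      simp only [this]
      exact insertCoord_dropCoord k z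
  refine (measure_mono hsub).trans_lt ((measure_iUnion_le _).trans_lt ?_)
  rw [tsum_fintype]
  refine ENNReal.sum_lt_top.2 fun q _ => ?_
  refine (euclideanHausdorffMeasure_image_le hPlip d _).trans_lt ?_
  rw [(isometry_insertCoord _ _).euclideanHausdorffMeasure_image,
    EuclideanSpace.euclideanHausdorffMeasure_eq_volume]
  exact measure_closedBall_lt_top

end Area

/-! ### Lattice points leaving a convex body under a translation. -/

section Counting

variable {D d : ℕ}

theorem one_le_norm_intEmbed {v : Fin D → ℤ} (hv : v ≠ 0) : 1 ≤ ‖intEmbed v‖ := by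
  obtain ⟨k, hk⟩ := Function.ne_iff.1 hv
  refine le_trans ?_ (abs_le_norm_intEmbed v k)
  exact_mod_cast Int.one_le_abs hk

theorem finite_intEmbed_mem {A : Set (EuclideanSpace ℝ (Fin D))} (hA : Bornology.IsBounded A) :
    {k : Fin D → ℤ | intEmbed k ∈ A}.Finite := by
  obtain ⟨M, hM⟩ := hA.exists_norm_le
  refine (Fintype.piFinset fun _ : Fin D => Finset.Icc (-⌊M⌋) ⌊M⌋).finite_toSet.subset ?_
  intro v hv
  rw [Finset.mem_coe, Fintype.mem_piFinset]
  intro k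
  have h2 := (abs_le_norm_intEmbed v k).trans (hM _ hv)
  rw [← Int.cast_abs] at h2
  exact Finset.mem_Icc.2 (abs_le.1 (Int.le_floor.2 h2))

/-- The number of lattice points in a convex set that contains a ball of radius `ρ` is at most a
multiple of the volume. -/
theorem card_mul_volume_ball_le {K : Set (EuclideanSpace ℝ (Fin d))} (hK : Convex ℝ K)
    {c : EuclideanSpace ℝ (Fin d)} {ρ : ℝ} (hρ : 0 < ρ) (hc : Metric.closedBall c ρ ⊆ K)
    (S : Finset (Fin d → ℤ)) (hS : ∀ k ∈ S, intEmbed k ∈ K) :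
    S.card * volume (Metric.ball (0 : EuclideanSpace ℝ (Fin d)) (1 / 2)) ≤
      ENNReal.ofReal ((1 + 1 / (2 * ρ)) ^ d) * volume K := by
  have hdisj : (S : Set (Fin d → ℤ)).PairwiseDisjoint fun k => Metric.ball (intEmbed k) (1 / 2) := by
    intro k _ k' _ hne
    refine Metric.ball_disjoint_ball ?_
    rw [dist_eq_norm, ← intEmbed_sub]
    have := one_le_norm_intEmbed (sub_ne_zero.2 hne)
    linarith
  -- With s = 1/(2ρ), a ball of radius 1/2 is s times a ball of radius ρ. By convexity K plus such a
  -- ball lies in the dilation of K about `c` by 1 + s.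
  have hsub : (⋃ k ∈ S, Metric.ball (intEmbed k) (1 / 2)) ⊆
      AffineMap.homothety c (1 + 1 / (2 * ρ)) '' K := by
    intro z hz
    simp only [Set.mem_iUnion] at hz
    obtain ⟨k, hk, hz⟩ := hz
    set s : ℝ := 1 / (2 * ρ)
    have hs : 0 < s := by positivity
    have hsρ : s * ρ = 1 / 2 := by simp only [s]; field_simp
    have hs1 : (1 + s) ≠ 0 := by positivity
    have hw : c + s⁻¹ • (z - intEmbed k) ∈ K := hc (by
      rw [Metric.mem_closedBall, dist_eq_norm, add_sub_cancel_left, norm_smul, norm_inv,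
        Real.norm_of_nonneg hs.le, inv_mul_le_iff₀ hs, hsρ, ← dist_eq_norm]
      exact (Metric.mem_ball.1 hz).le)
    refine ⟨(1 + s)⁻¹ • intEmbed k + ((1 + s)⁻¹ * s) • (c + s⁻¹ • (z - intEmbed k)),
      hK (hS k hk) hw (by positivity) (by positivity) (by field_simp), ?_⟩
    rw [AffineMap.homothety_apply, vsub_eq_sub, vadd_eq_add, smul_sub, smul_add, smul_smul,
      smul_smul, ← mul_assoc, mul_inv_cancel₀ hs1, one_smul, one_mul, smul_add, smul_smul,
      mul_inv_cancel₀ hs.ne', one_smul, add_smul, one_smul]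
    abel
  calc S.card * volume (Metric.ball (0 : EuclideanSpace ℝ (Fin d)) (1 / 2))
      = ∑ k ∈ S, volume (Metric.ball (intEmbed k) (1 / 2)) := by
        rw [← nsmul_eq_mul, ← Finset.sum_const]
        exact Finset.sum_congr rfl fun k _ => (Measure.addHaar_ball_center volume _ _).symm
    _ = volume (⋃ k ∈ S, Metric.ball (intEmbed k) (1 / 2)) :=
        (measure_biUnion_finset hdisj fun k _ => measurableSet_ball).symm
    _ ≤ volume (AffineMap.homothety c (1 + 1 / (2 * ρ)) '' K) := measure_mono hsub
    _ = _ := by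
        rw [Measure.addHaar_image_homothety, finrank_euclideanSpace_fin,
          abs_of_nonneg (by positivity)]

/-- The number of lattice points that leave `A` when translated by `x`. -/
noncomputable def exitCount (A : Set (EuclideanSpace ℝ (Fin D))) (x : Fin D → ℤ) : ℝ :=
  ({k : Fin D → ℤ | intEmbed k ∈ A ∧ intEmbed (k + x) ∉ A}.ncard : ℝ)

theorem exitCount_zero (A : Set (EuclideanSpace ℝ (Fin D))) : exitCount A 0 = 0 := by
  simp [exitCount]

/-- A point leaving A under x + y either leaves under x, or its translate by x lies in A and leaves
under y. -/
theorem exitCount_add_le {A : Set (EuclideanSpace ℝ (Fin D))} (hA : Bornology.IsBounded A)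
    (x y : Fin D → ℤ) : exitCount A (x + y) ≤ exitCount A x + exitCount A y := by
  have hfin : ∀ x, {k : Fin D → ℤ | intEmbed k ∈ A ∧ intEmbed (k + x) ∉ A}.Finite := fun x =>
    (finite_intEmbed_mem hA).subset fun k hk => hk.1
  have hsub : {k : Fin D → ℤ | intEmbed k ∈ A ∧ intEmbed (k + (x + y)) ∉ A} ⊆
      {k | intEmbed k ∈ A ∧ intEmbed (k + x) ∉ A} ∪
        (fun k => k - x) '' {k | intEmbed k ∈ A ∧ intEmbed (k + y) ∉ A} := by
    intro k hk
    by_cases h : intEmbed (k + x) ∈ A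
    · exact Or.inr ⟨k + x, ⟨h, by rw [add_assoc]; exact hk.2⟩, by simp⟩
    · exact Or.inl ⟨hk.1, h⟩
  have h1 := Set.ncard_le_ncard hsub ((hfin x).union ((hfin y).image _))
  have h2 := h1.trans (Set.ncard_union_le _ _)
  have h3 := h2.trans (add_le_add_right (Set.ncard_image_le (hfin y)) _)
  simp only [exitCount]
  exact_mod_cast h3

/-- Of two points of A on one lattice line, the one behind cannot leave by a unit step: by convexity
the step stays on the segment between them. Dropping coordinate i is thus injective on the leaving
points. -/
theorem exitCount_single_le (i : Fin (d + 1)) {A : Set (EuclideanSpace ℝ (Fin (d + 1)))}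
    (hA : Bornology.IsBounded A) (hconv : Convex ℝ A) {σ : ℤ} (hσ : σ = 1 ∨ σ = -1) :
    exitCount A (Pi.single i σ) ≤
      ({m : Fin d → ℤ | intEmbed m ∈ dropCoord i '' A}.ncard : ℝ) := by
  have hfin : {m : Fin d → ℤ | intEmbed m ∈ dropCoord i '' A}.Finite :=
    finite_intEmbed_mem ((lipschitzWith_dropCoord i).isBounded_image hA)
  have hmem : ∀ k k' : Fin (d + 1) → ℤ, intEmbed k ∈ A → intEmbed k' ∈ A →
      (∀ j, k (i.succAbove j) = k' (i.succAbove j)) → 0 < σ * (k' i - k i) →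
      intEmbed (k + Pi.single i σ) ∈ A := by
    intro k k' hk hk' heq hpos
    set θ : ℝ := 1 / (σ * (k' i - k i) : ℤ)
    have hn : (1 : ℝ) ≤ (σ * (k' i - k i) : ℤ) := by exact_mod_cast hpos
    have hθ0 : 0 ≤ θ := by positivity
    have hθ1 : θ ≤ 1 := by
      simp only [θ]
      rw [div_le_one (by linarith)]
      exact hn
    have hσ2 : (σ : ℝ) * σ = 1 := by
      rcases hσ with h | h <;> rw [h] <;> norm_num
    have hθ : θ * ((k' i : ℝ) - k i) = σ := by
      have h1 : θ * (σ * (k' i - k i) : ℤ) = 1 := by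
        simp only [θ]
        exact div_mul_cancel₀ _ (by linarith)
      push_cast at h1
      calc θ * ((k' i : ℝ) - k i) = (σ * σ) * (θ * ((k' i : ℝ) - k i)) := by rw [hσ2, one_mul]
        _ = σ * (θ * (σ * (k' i - k i))) := by ring
        _ = σ := by rw [h1, mul_one]
    have := hconv hk hk' (by linarith : 0 ≤ 1 - θ) hθ0 (by ring)
    convert this using 1
    ext j
    rcases Fin.eq_self_or_eq_succAbove i j with rfl | ⟨j, rfl⟩
    · simp only [intEmbed, Pi.add_apply, Pi.single_eq_same, Int.cast_add, PiLp.add_apply,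
        PiLp.smul_apply, smul_eq_mul]
      linarith
    · simp only [intEmbed, Pi.add_apply, PiLp.add_apply, PiLp.smul_apply, smul_eq_mul, ← heq j,
        Pi.single_eq_of_ne (Fin.succAbove_ne i j), add_zero]
      ring
  simp only [exitCount]
  refine Nat.cast_le.2 (Set.ncard_le_ncard_of_injOn (fun k j => k (i.succAbove j)) ?_ ?_ hfin)
  · intro k hk
    exact ⟨intEmbed k, hk.1, by ext j; simp [dropCoord, intEmbed]⟩
  · intro k hk k' hk' heq
    have heq' : ∀ j, k (i.succAbove j) = k' (i.succAbove j) := fun j => congrFun heq j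
    have hi : k i = k' i := by
      by_contra hne
      rcases hσ with rfl | rfl
      · rcases lt_or_gt_of_ne hne with h | h
        · exact hk.2 (hmem k k' hk.1 hk'.1 heq' (by linarith))
        · exact hk'.2 (hmem k' k hk'.1 hk.1 (fun j => (heq' j).symm) (by linarith))
      · rcases lt_or_gt_of_ne hne with h | h
        · exact hk'.2 (hmem k' k hk'.1 hk.1 (fun j => (heq' j).symm) (by linarith))
        · exact hk.2 (hmem k k' hk.1 hk'.1 heq' (by linarith))
    ext j
    rcases Fin.eq_self_or_eq_succAbove i j with rfl | ⟨j, rfl⟩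
    · exact hi
    · exact heq' j

theorem exitCount_nsmul_le {A : Set (EuclideanSpace ℝ (Fin D))} (hA : Bornology.IsBounded A)
    (n : ℕ) (x : Fin D → ℤ) : exitCount A (n • x) ≤ n * exitCount A x := by
  induction n with
  | zero => simp [exitCount_zero]
  | succ n ih =>
    rw [succ_nsmul]
    refine (exitCount_add_le hA _ _).trans ?_
    push_cast
    linarith

theorem exitCount_sum_le {A : Set (EuclideanSpace ℝ (Fin D))} (hA : Bornology.IsBounded A)
    {κ : Type*} (s : Finset κ) (f : κ → Fin D → ℤ) :
    exitCount A (∑ i ∈ s, f i) ≤ ∑ i ∈ s, exitCount A (f i) := by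
  classical
  induction s using Finset.induction_on with
  | empty => simp [exitCount_zero]
  | insert i s hi ih =>
    rw [Finset.sum_insert hi, Finset.sum_insert hi]
    exact (exitCount_add_le hA _ _).trans (add_le_add_right ih _)

/-- The translation is a sum of |x_i| unit steps along each axis, and each |x_i| is at most the hop
length. -/
theorem exitCount_le_of_single_le {A : Set (EuclideanSpace ℝ (Fin D))}
    (hA : Bornology.IsBounded A) {b : ℝ} (hb : 0 ≤ b)
    (h : ∀ i, ∀ σ : ℤ, σ = 1 ∨ σ = -1 → exitCount A (Pi.single i σ) ≤ b) (x : Fin D → ℤ) :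
    exitCount A x ≤ D * b * hopLength x := by
  have hx : x = ∑ i, (x i).natAbs • Pi.single i ((if 0 ≤ x i then 1 else -1 : ℤ)) := by
    conv_lhs => rw [← Finset.univ_sum_single x]
    refine Finset.sum_congr rfl fun i _ => ?_
    rw [← Pi.single_smul]
    congr 1
    split_ifs with h0 <;> simp only [nsmul_eq_mul] <;> omega
  have h1 : ∀ i, exitCount A ((x i).natAbs • Pi.single i ((if 0 ≤ x i then 1 else -1 : ℤ))) ≤
      hopLength x * b := fun i => by
    refine (exitCount_nsmul_le hA _ _).trans ?_
    have h2 : ((x i).natAbs : ℝ) ≤ hopLength x := by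
      rw [Nat.cast_natAbs, Int.cast_abs]
      exact (abs_le_norm_intEmbed x i).trans (le_max_right _ _)
    have h3 := h i _ (by split_ifs <;> simp : (if 0 ≤ x i then 1 else -1 : ℤ) = 1 ∨
      (if 0 ≤ x i then 1 else -1 : ℤ) = -1)
    calc ((x i).natAbs : ℝ) * _ ≤ (x i).natAbs * b := by gcongr
      _ ≤ hopLength x * b := by gcongr
  calc exitCount A x ≤ ∑ i : Fin D, hopLength x * b := by
        conv_lhs => rw [hx]
        exact (exitCount_sum_le hA _ _).trans (Finset.sum_le_sum fun i _ => h1 i)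
    _ = _ := by simp; ring

/-- The number of lattice points of a convex body that leave it under a translation by `x` is at
most a multiple of `|x|` times the area of its boundary. -/
theorem exists_exitCount_le (d : ℕ) {ρ : ℝ} (hρ : 0 < ρ) :
    ∃ K : ℝ, 0 < K ∧ ∀ A : Set (EuclideanSpace ℝ (Fin (d + 1))), IsCompact A → Convex ℝ A →
      (interior A).Nonempty → (1 ≤ d → ∃ x, Metric.closedBall x ρ ⊆ A) →
      ∀ x, exitCount A x ≤ K * boundaryArea A * hopLength x := by
  set ω : ℝ := (volume (Metric.ball (0 : EuclideanSpace ℝ (Fin d)) (1 / 2))).toReal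
  have hω : 0 < ω := ENNReal.toReal_pos (Metric.measure_ball_pos _ _ (by norm_num)).ne'
    measure_ball_lt_top.ne
  refine ⟨(d + 1 : ℕ) * ((1 + 1 / (2 * ρ)) ^ d / ω), by positivity,
    fun A hA hconv hint hball x => ?_⟩
  have hΦ : boundaryArea A =
      (Measure.euclideanHausdorffMeasure d (frontier A)).toReal := rfl
  -- Finiteness is essential: `boundaryArea` is a `toReal`, which would turn an infinite area into
  -- 0.
  have hfinite := euclideanHausdorffMeasure_frontier_lt_top hA hconv hint
  have hsingle : ∀ i, ∀ σ : ℤ, σ = 1 ∨ σ = -1 → exitCount A (Pi.single i σ) ≤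
      (1 + 1 / (2 * ρ)) ^ d / ω * boundaryArea A := by
    intro i σ hσ
    refine (exitCount_single_le i hA.isBounded hconv hσ).trans ?_
    have hc : ∃ c, Metric.closedBall c ρ ⊆ dropCoord i '' A := by
      -- In dimension one the shadow is a single point, so no inner ball is needed.
      rcases Nat.eq_zero_or_pos d with rfl | hd
      · obtain ⟨y, hy⟩ := hint
        refine ⟨dropCoord i y, fun z _ => ⟨y, interior_subset hy, Subsingleton.elim _ _⟩⟩
      · obtain ⟨y, hy⟩ := hball hd
        exact ⟨_, closedBall_subset_image_dropCoord i hy⟩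
    obtain ⟨c, hc⟩ := hc
    have hfin : {m : Fin d → ℤ | intEmbed m ∈ dropCoord i '' A}.Finite :=
      finite_intEmbed_mem ((lipschitzWith_dropCoord i).isBounded_image hA.isBounded)
    have h1 := card_mul_volume_ball_le (convex_image_dropCoord i hconv) hρ hc hfin.toFinset
      fun k hk => hfin.mem_toFinset.1 hk
    have h2 := h1.trans (mul_le_mul_right (volume_image_dropCoord_le i hA.isBounded) _)
    have h3 := ENNReal.toReal_mono (ENNReal.mul_ne_top ENNReal.ofReal_ne_top hfinite.ne) h2
    rw [ENNReal.toReal_mul, ENNReal.toReal_mul, ENNReal.toReal_natCast,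
      ENNReal.toReal_ofReal (by positivity)] at h3
    rw [Set.ncard_eq_toFinset_card _ hfin, hΦ, div_mul_eq_mul_div, le_div_iff₀ hω]
    exact h3
  have hb : 0 ≤ (1 + 1 / (2 * ρ)) ^ d / ω * boundaryArea A :=
    mul_nonneg (by positivity) ENNReal.toReal_nonneg
  refine (exitCount_le_of_single_le hA.isBounded hb hsingle x).trans_eq ?_
  ring

end Counting

/-! ### Operators with disjoint supports commute. -/

section Support

variable {D : ℕ} {Λ : Finset (Fin D → ℕ)} {q : Λ → ℕ}

open scoped Classical in
-- Only one intermediate configuration contributes: `y` on S and `x` elsewhere. The resulting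
-- formula is symmetric in the two factors.
theorem mul_apply_of_disjoint {S T : Set Λ} (hST : Disjoint S T) {M N : Op Λ q}
    {M' : Matrix ((i : S) → Fin (q i)) ((i : S) → Fin (q i)) ℂ}
    {N' : Matrix ((i : T) → Fin (q i)) ((i : T) → Fin (q i)) ℂ}
    (hM : ∀ x y : Config Λ q,
      M x y = if ∀ i, i ∉ S → x i = y i then M' (fun i => x i) (fun i => y i) else 0)
    (hN : ∀ x y : Config Λ q,
      N x y = if ∀ i, i ∉ T → x i = y i then N' (fun i => x i) (fun i => y i) else 0)
    (x y : Config Λ q) : (M * N) x y = if ∀ i, i ∉ S → i ∉ T → x i = y i then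
      M' (fun i => x i) (fun i => y i) * N' (fun i => x i) (fun i => y i) else 0 := by
  have hST' : ∀ i, i ∈ S → i ∉ T := fun i h h' => Set.disjoint_left.1 hST h h'
  set z : Config Λ q := fun i => if i ∈ S then y i else x i
  rw [Matrix.mul_apply, Finset.sum_eq_single z]
  · rw [hM, hN, if_pos fun i hi => by simp [z, hi]]
    have e1 : (fun i : S => z i) = fun i : S => y i := by ext i; simp [z]
    have e2 : (fun i : T => z i) = fun i : T => x i := by
      ext i
      have : (i : Λ) ∉ S := fun h => hST' _ h i.2
      simp [z, this]
    have e3 : (∀ i, i ∉ T → z i = y i) ↔ ∀ i, i ∉ S → i ∉ T → x i = y i := by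
      refine ⟨fun h i hS hT => by simpa [z, hS] using h i hT, fun h i hT => ?_⟩
      by_cases hS : i ∈ S
      · simp [z, hS]
      · simpa [z, hS] using h i hS hT
    rw [e1, e2]
    simp only [e3]
    split_ifs <;> simp
  · intro z' _ hne
    rw [hM, hN]
    by_cases h1 : ∀ i, i ∉ S → x i = z' i
    · by_cases h2 : ∀ i, i ∉ T → z' i = y i
      · refine absurd (funext fun i => ?_) hne
        by_cases hS : i ∈ S
        · simp only [z, if_pos hS]; exact h2 i (hST' i hS)
        · simp only [z, if_neg hS]; exact (h1 i hS).symm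
      · rw [if_neg h2, mul_zero]
    · rw [if_neg h1, zero_mul]
  · simp

theorem SupportedOn.commute {S T : Set Λ} (hST : Disjoint S T) {M N : Op Λ q}
    (hM : SupportedOn S M) (hN : SupportedOn T N) : Commute M N := by
  obtain ⟨M', hM⟩ := hM
  obtain ⟨N', hN⟩ := hN
  ext x y
  rw [mul_apply_of_disjoint hST hM hN, mul_apply_of_disjoint hST.symm hN hM, mul_comm]
  congr 1
  exact propext ⟨fun h i hT hS => h i hS hT, fun h i hS hT => h i hT hS⟩

end Support

/-! ### Lattice sites as a local system. -/

section Sites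

variable {D : ℕ} {Λ : Finset (Fin D → ℕ)} {q : Λ → ℕ}

/-- The integer coordinates of a site. -/
def sitePos (i : Λ) : Fin D → ℤ := fun k => ((i : Fin D → ℕ) k : ℤ)

theorem sitePos_injective : Function.Injective (sitePos (Λ := Λ)) := fun i j h =>
  Subtype.ext (funext fun k => by simpa [sitePos] using congrFun h k)

theorem intEmbed_sitePos (i : Λ) : intEmbed (sitePos i) = embed (i : Fin D → ℕ) := by
  ext k; simp [intEmbed, sitePos, embed]

theorem norm_intEmbed_sitePos_sub (i j : Λ) : ‖intEmbed (sitePos i - sitePos j)‖ =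
    dist (embed (i : Fin D → ℕ)) (embed (j : Fin D → ℕ)) := by
  rw [intEmbed_sub, intEmbed_sitePos, intEmbed_sitePos, dist_eq_norm]

theorem one_le_dist_embed {i j : Λ} (hij : i ≠ j) :
    1 ≤ dist (embed (i : Fin D → ℕ)) (embed (j : Fin D → ℕ)) := by
  rw [← norm_intEmbed_sitePos_sub]
  exact one_le_norm_intEmbed (sub_ne_zero.2 fun h => hij (sitePos_injective h))

theorem siteDist_le {X Y : Set (EuclideanSpace ℝ (Fin D))} {i j : Λ}
    (hi : embed (i : Fin D → ℕ) ∈ X) (hj : embed (j : Fin D → ℕ) ∈ Y) :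
    siteDist Λ X Y ≤ dist (embed (i : Fin D → ℕ)) (embed (j : Fin D → ℕ)) := by
  refine csInf_le ⟨0, ?_⟩ ⟨i, i.2, j, j.2, hi, hj, rfl⟩
  rintro _ ⟨i, _, j, _, _, _, rfl⟩
  exact dist_nonneg

theorem one_le_siteDist {X Y : Set (EuclideanSpace ℝ (Fin D))} (hXY : Disjoint X Y) {i j : Λ}
    (hi : embed (i : Fin D → ℕ) ∈ X) (hj : embed (j : Fin D → ℕ) ∈ Y) : 1 ≤ siteDist Λ X Y := by
  refine le_csInf ⟨_, i, i.2, j, j.2, hi, hj, rfl⟩ ?_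
  rintro _ ⟨i, hiΛ, j, hjΛ, hi, hj, rfl⟩
  refine one_le_dist_embed (i := ⟨i, hiΛ⟩) (j := ⟨j, hjΛ⟩) fun h => ?_
  have h' : i = j := congrArg Subtype.val h
  exact Set.disjoint_left.1 hXY hi (h' ▸ hj)

theorem hamiltonian_eq_interactionSum (h : Λ → Λ → ℝ → Op Λ q)
    {X : Set (EuclideanSpace ℝ (Fin D))} {S : Finset Λ}
    (hS : ∀ i : Λ, embed (i : Fin D → ℕ) ∈ X ↔ i ∈ S) :
    hamiltonian h X = interactionSum h (S ×ˢ S) := by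
  classical
  ext1 s
  simp only [hamiltonian, interactionSum, hS]
  rw [Finset.sum_product, ← Finset.sum_filter_add_sum_filter_not Finset.univ (· ∈ S),
    Finset.filter_univ_mem]
  rw [Finset.sum_eq_zero (s := Finset.univ.filter _), add_zero]
  · refine Finset.sum_congr rfl fun i hi => ?_
    simp only [hi, true_and]
    rw [← Finset.sum_filter, Finset.filter_univ_mem]
  · intro i hi
    simp [(Finset.mem_filter.1 hi).2]

theorem isEvolution_interactionSum {α : ℝ} {h : Λ → Λ → ℝ → Op Λ q}
    (hh : IsPowerLawInteraction Λ q α h) (S : Finset (Λ × Λ)) :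
    IsEvolution (interactionSum h S) (timeOrderedExp (interactionSum h S) 0) := by
  refine timeOrderedExp_isEvolution (fun t => ?_) fun s =>
    isSelfAdjoint_sum _ fun p _ => hh.hermitian p.1 p.2 s
  have := IntervalIntegrable.sum S fun p _ => hh.integrable p.1 p.2 0 t
  refine this.congr fun s _ => ?_
  simp [interactionSum]

/-- Hop lengths are at least 1, so the row sums for every admissible α are dominated by those for
the exponent D + 1. This keeps `lam`, and with it the velocity, independent of α. -/
theorem isLocalSystem {α lam : ℝ} (hα : (D : ℝ) + 1 ≤ α)
    (hlam : ∀ V : Finset (Fin D → ℤ), ∑ v ∈ V, hopLength v ^ (-((D : ℝ) + 1)) ≤ lam)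
    {h : Λ → Λ → ℝ → Op Λ q} (hh : IsPowerLawInteraction Λ q α h) :
    IsLocalSystem h (fun i j => hopLength (sitePos i - sitePos j) ^ (-α)) lam where
  selfAdjoint i j s := hh.hermitian i j s
  commute i j k l s s' h1 h2 h3 h4 := SupportedOn.commute (by simp [h1, h2, h3, h4, eq_comm])
    (hh.supported i j s) (hh.supported k l s')
  exists_evolution S := ⟨_, isEvolution_interactionSum hh S⟩
  norm_le i j s hij := by
    refine (hh.decay i j s hij).trans_eq ?_
    rw [hopLength, norm_intEmbed_sitePos_sub, max_eq_right (one_le_dist_embed hij),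
      Real.rpow_neg dist_nonneg, one_div]
  nonneg i j := Real.rpow_nonneg (zero_le_one.trans (one_le_hopLength _)) _
  symm i j := by
    rw [hopLength, hopLength, norm_intEmbed_sitePos_sub, norm_intEmbed_sitePos_sub, dist_comm]
  self i := by
    rw [hopLength, norm_intEmbed_sitePos_sub, dist_self, max_eq_left zero_le_one, Real.one_rpow]
  sum_le i := by
    have hinj : Function.Injective fun j : Λ => sitePos i - sitePos j := fun j j' h' =>
      sitePos_injective (sub_right_injective h')
    refine le_trans ?_ (hlam (Finset.univ.map ⟨_, hinj⟩))
    rw [Finset.sum_map]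
    exact Finset.sum_le_sum fun j _ =>
      Real.rpow_le_rpow_of_exponent_le (one_le_hopLength _) (neg_le_neg hα)

end Sites

/-! ### Uniform constants and the final estimate. -/

theorem sum_hopLength_rpow_tail_le {D : ℕ} {δ C α : ℝ}
    (hC : ∀ (V : Finset (Fin D → ℤ)) (r : ℝ), 0 < r →
      ∑ v ∈ V.filter (fun v => r ≤ hopLength v), hopLength v ^ (-(D + δ)) ≤ C * r ^ (-δ))
    (hα : (D : ℝ) + 1 + δ ≤ α) (V : Finset (Fin D → ℤ)) (r : ℝ) (hr : 0 < r) :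
    ∑ v ∈ V.filter (fun v => r ≤ hopLength v), hopLength v ^ (1 - α) ≤
      C * r ^ (-(α - D - 1)) := by
  have h1 : ∀ v ∈ V.filter (fun v => r ≤ hopLength v), hopLength v ^ (1 - α) ≤
      r ^ (-(α - D - 1 - δ)) * hopLength v ^ (-(D + δ)) := by
    intro v hv
    have hv0 : 0 < hopLength v := zero_lt_one.trans_le (one_le_hopLength v)
    -- On the tail, the power beyond -(D + δ) is bounded by its value at r; the constant for δ thus
    -- serves all larger α.
    rw [show 1 - α = -(α - D - 1 - δ) + -(D + δ) by ring, Real.rpow_add hv0]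
    exact mul_le_mul_of_nonneg_right (Real.rpow_le_rpow_of_nonpos hr (Finset.mem_filter.1 hv).2
      (by linarith)) (Real.rpow_nonneg hv0.le _)
  refine (Finset.sum_le_sum h1).trans ?_
  rw [← Finset.mul_sum]
  calc r ^ (-(α - D - 1 - δ)) * _ ≤ r ^ (-(α - D - 1 - δ)) * (C * r ^ (-δ)) := by
        gcongr
        exact hC V r hr
    _ = C * r ^ (-(α - D - 1)) := by
        rw [mul_left_comm, ← Real.rpow_add hr]
        congr 2
        ring

/-- The path estimate produces (1-γ)^{-(α-D-1)}, so the 16 and the larger exponent in `xi` only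
loosen the bound. -/
theorem exp_add_rpow_le_xi {D : ℕ} {γ α ℓ : ℝ} (hγ0 : 0 < γ) (hγ1 : γ < 1)
    (hα : (D : ℝ) + 1 ≤ α) (hℓ : 0 < ℓ) (m : ℕ) :
    Real.exp (2 * m - γ * ℓ) + ((1 - γ) * ℓ) ^ (-(α - D - 1)) ≤
      Real.exp 2 ^ m * xi D γ α ℓ := by
  have hγ : 0 < 1 - γ := by linarith
  have hD : (0 : ℝ) ≤ D := D.cast_nonneg
  have h1 : Real.exp (2 * m - γ * ℓ) = Real.exp 2 ^ m * Real.exp (-(γ * ℓ)) := by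
    rw [← Real.exp_nat_mul, ← Real.exp_add]
    congr 1
    ring
  have h2 : ((1 - γ) * ℓ) ^ (-(α - D - 1)) ≤ (16 / (1 - γ)) ^ α * (1 / ℓ ^ (α - D - 1)) := by
    rw [Real.mul_rpow hγ.le hℓ.le, Real.rpow_neg hγ.le, Real.rpow_neg hℓ.le, one_div,
      ← Real.inv_rpow hγ.le]
    have h3 : (1 : ℝ) ≤ (1 - γ)⁻¹ := (one_le_inv₀ hγ).2 (by linarith)
    have h4 : (1 - γ)⁻¹ ≤ 16 / (1 - γ) := by
      rw [div_eq_mul_inv]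
      linarith
    gcongr
    calc (1 - γ)⁻¹ ^ (α - D - 1) ≤ (1 - γ)⁻¹ ^ α :=
          Real.rpow_le_rpow_of_exponent_le h3 (by linarith)
      _ ≤ _ := Real.rpow_le_rpow (by linarith) h4 (by linarith)
  have h5 : 1 ≤ Real.exp 2 ^ m := one_le_pow₀ (Real.one_le_exp (by norm_num))
  have h6 : 0 ≤ (16 / (1 - γ)) ^ α * (1 / ℓ ^ (α - D - 1)) := by positivity
  rw [xi, h1, mul_add]
  nlinarith

/-- Since the zeroth term contributes nothing, the exponential series starts at m = 1, whence the
factor e^{cμt} - 1. -/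
theorem sum_expPartialSum_le {ι : Type*} [Fintype ι] {w : ι → ι → ℝ} {g : ι → ℝ} (s : Finset ι)
    {G μ c : ℝ} (hG : 0 ≤ G) (hμ : 0 ≤ μ) (hc : 0 ≤ c) (h0 : ∑ j ∈ s, kernelIter w g 0 j ≤ 0)
    (h : ∀ m, ∑ j ∈ s, kernelIter w g m j ≤ G * μ ^ m) (n : ℕ) {t : ℝ} (ht : 0 ≤ t) :
    ∑ j ∈ s, expPartialSum w g c (n + 1) t j ≤ G * (Real.exp (c * μ * t) - 1) := by
  simp only [expPartialSum]
  rw [Finset.sum_comm]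
  simp only [← Finset.mul_sum]
  rw [Finset.sum_range_succ']
  have h1 := Real.sum_le_exp_of_nonneg (x := c * μ * t) (by positivity) (n + 1)
  rw [Finset.sum_range_succ'] at h1
  simp only [pow_zero, Nat.factorial_zero, Nat.cast_one, div_one, one_mul] at h1 ⊢
  have h2 : ∑ m ∈ Finset.range n, (c * t) ^ (m + 1) / (m + 1).factorial *
      ∑ j ∈ s, kernelIter w g (m + 1) j ≤
      G * ∑ m ∈ Finset.range n, (c * μ * t) ^ (m + 1) / (m + 1).factorial := by
    rw [Finset.mul_sum]
    refine Finset.sum_le_sum fun m _ => ?_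
    calc (c * t) ^ (m + 1) / (m + 1).factorial * ∑ j ∈ s, kernelIter w g (m + 1) j
        ≤ (c * t) ^ (m + 1) / (m + 1).factorial * (G * μ ^ (m + 1)) := by
          gcongr
          exact h _
      _ = _ := by rw [show c * μ * t = (c * t) * μ by ring, mul_pow]; ring
  nlinarith

section Main

variable {D : ℕ} {Λ : Finset (Fin D → ℕ)}

theorem sum_kernelIter_sites_le {A C : Set (EuclideanSpace ℝ (Fin D))} (hAC : Disjoint A C)
    (hA : IsCompact A) {b c₁ lam α γ : ℝ} (hb : 0 ≤ b) (hc₁ : 0 ≤ c₁) (hlam1 : 1 ≤ lam)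
    (hcount : ∀ x, exitCount A x ≤ b * hopLength x)
    (hlam : ∀ V : Finset (Fin D → ℤ), ∑ v ∈ V, hopLength v ^ (-((D : ℝ) + 1)) ≤ lam)
    (htail : ∀ (V : Finset (Fin D → ℤ)) (r : ℝ), 0 < r →
      ∑ v ∈ V.filter (fun v => r ≤ hopLength v), hopLength v ^ (1 - α) ≤
        c₁ * r ^ (-(α - D - 1)))
    (hα : (D : ℝ) + 1 ≤ α) (hγ0 : 0 < γ) (hγ1 : γ < 1) (a c : Finset Λ)
    (ha : ∀ i ∈ a, embed (i : Fin D → ℕ) ∈ A) (hc : ∀ i ∈ c, embed (i : Fin D → ℕ) ∈ C)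
    (hxi : 0 ≤ xi D γ α (siteDist Λ A C)) (m : ℕ) :
    ∑ j ∈ c, kernelIter (fun x z => hopLength (sitePos x - sitePos z) ^ (-α))
      (fun x => if x ∈ a then (1 : ℝ) else 0) m j ≤
      b * c₁ * xi D γ α (siteDist Λ A C) * (2 * Real.exp 2 * lam) ^ m := by
  have hsum : ∀ V : Finset (Fin D → ℤ), ∑ v ∈ V, hopLength v ^ (α - D - 1 - α) ≤ lam := by
    intro V
    rw [show α - D - 1 - α = -((D : ℝ) + 1) by ring]
    exact hlam V
  by_cases hne : a.Nonempty ∧ c.Nonempty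
  · obtain ⟨⟨i, hi⟩, ⟨j, hj⟩⟩ := hne
    have hℓ := zero_lt_one.trans_le (one_le_siteDist hAC (ha i hi) (hc j hj))
    refine (sum_kernelIter_le sitePos_injective htail hc₁ hsum hγ0 hγ1 hℓ a c
      (fun i hi j hj => ?_) (N := exitCount A) (fun x => ?_) (exitCount_zero A).le
      (exitCount_add_le hA.isBounded) hb hcount m).trans ?_
    · rw [norm_intEmbed_sitePos_sub, dist_comm]
      exact siteDist_le (ha i hi) (hc j hj)
    · rw [exitCount, ← Set.ncard_coe_finset]
      refine Nat.cast_le.2 (Set.ncard_le_ncard_of_injOn (fun j => sitePos j - x)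
        (fun j hj => ?_) (fun j _ j' _ h => sitePos_injective (sub_left_injective h))
        ((finite_intEmbed_mem hA.isBounded).subset fun k hk => hk.1))
      obtain ⟨hj, i, hi, hij⟩ := Finset.mem_filter.1 hj
      refine ⟨?_, ?_⟩
      · rw [← hij, intEmbed_sitePos]
        exact ha i hi
      · rw [sub_add_cancel, intEmbed_sitePos]
        exact Set.disjoint_right.1 hAC (hc j hj)
    · have h1 := exp_add_rpow_le_xi hγ0 hγ1 hα hℓ m
      -- Trades the factor m, from the choice of the singled-out hop, for a geometric one; this is
      -- the 2 in `2 * Real.exp 2 * lam`.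
      have h2 : (m : ℝ) ≤ 2 ^ m := by exact_mod_cast Nat.lt_two_pow_self.le
      have h3 : lam ^ (m - 1) ≤ lam ^ m := pow_le_pow_right₀ hlam1 (Nat.sub_le m 1)
      calc _ ≤ b * (c₁ * 2 ^ m * lam ^ m * (Real.exp 2 ^ m * xi D γ α (siteDist Λ A C))) := by
            gcongr
        _ = _ := by rw [mul_pow, mul_pow]; ring
  -- If `a` or `c` is empty, the distance condition is vacuous, so ℓ = 1 and the zero counting
  -- function are allowed and the path sum is at most 0.
  · refine (sum_kernelIter_le sitePos_injective htail hc₁ hsum hγ0 hγ1 zero_lt_one a c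
      (fun i hi j hj => absurd ⟨⟨i, hi⟩, ⟨j, hj⟩⟩ hne) (N := fun _ => 0) (b := 0) (fun x => ?_)
      le_rfl (by simp) le_rfl (by simp) m).trans ?_
    · rw [Finset.filter_false_of_mem]
      · simp
      · rintro j hj ⟨i, hi, -⟩
        exact hne ⟨⟨i, hi⟩, ⟨j, hj⟩⟩
    · rw [zero_mul]
      positivity

end Main

end PowerLaw

theorem lemma1 (D : ℕ) (hD : 1 ≤ D) :
    ∃ v : ℝ, 0 < v ∧ ∀ δ : ℝ, 0 < δ → ∀ ρ : ℝ, 0 < ρ → ∃ c₀ : ℝ, 0 < c₀ ∧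
      ∀ γ : ℝ, 0 < γ → γ < 1 → ∀ α : ℝ, (D : ℝ) + 1 + δ ≤ α →
      ∀ (Λ : Finset (Fin D → ℕ)) (q : Λ → ℕ) (h : Λ → Λ → ℝ → PowerLaw.Op Λ q),
        PowerLaw.IsPowerLawInteraction Λ q α h →
      ∀ A B C : Set (EuclideanSpace ℝ (Fin D)),
        (interior A).Nonempty → (interior B).Nonempty → (interior C).Nonempty →
        A ∪ B ∪ C = Set.univ → Disjoint A C → IsCompact A → Convex ℝ A →
        (2 ≤ D → ∃ x, Metric.closedBall x ρ ⊆ A) →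
      ∀ t : ℝ, 0 ≤ t →
        ‖PowerLaw.evolution h (A ∪ B ∪ C) 0 t -
            PowerLaw.evolution h (A ∪ B) 0 t * (PowerLaw.evolution h B 0 t)ᴴ *
              PowerLaw.evolution h (B ∪ C) 0 t‖ ≤
          c₀ * (Real.exp (v * t) - 1) * PowerLaw.boundaryArea A *
            PowerLaw.xi D γ α (PowerLaw.siteDist Λ A C) := by
  classical
  obtain ⟨d, rfl⟩ := Nat.exists_eq_add_of_le' hD
  -- The lattice sum with exponent D + 1 is fixed before δ and ρ, so the velocity depends on D
  -- alone. It is the product of the commutator rate `4 * (lam + 1)` and the cost `2 * Real.exp 2 *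
  -- lam` per hop.
  obtain ⟨lam, hlam1, hlam'⟩ := PowerLaw.exists_sum_hopLength_rpow_le (d + 1) one_pos
  have hlam : ∀ V : Finset (Fin (d + 1) → ℤ),
      ∑ v ∈ V, PowerLaw.hopLength v ^ (-(((d + 1 : ℕ) : ℝ) + 1)) ≤ lam := fun V => by
    have := hlam' V 1 one_pos
    rwa [Real.one_rpow, mul_one, Finset.filter_true_of_mem fun v _ =>
      PowerLaw.one_le_hopLength v] at this
  refine ⟨4 * (lam + 1) * (2 * Real.exp 2 * lam), by positivity, fun δ hδ ρ hρ => ?_⟩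
  obtain ⟨c₁, hc₁, htail⟩ := PowerLaw.exists_sum_hopLength_rpow_le (d + 1) hδ
  obtain ⟨K, hK, hcount⟩ := PowerLaw.exists_exitCount_le d hρ
  refine ⟨K * c₁, by positivity, ?_⟩
  intro γ hγ0 hγ1 α hα Λ q h hh A B C hAi _ _ hABC hAC hA hAconv hball t ht
  have hα' : ((d + 1 : ℕ) : ℝ) + 1 ≤ α := by linarith
  set Ξ := PowerLaw.xi (d + 1) γ α (PowerLaw.siteDist Λ A C)
  have hℓ : 0 ≤ PowerLaw.siteDist Λ A C :=
    Real.sInf_nonneg (by rintro _ ⟨_, _, _, _, _, _, rfl⟩; exact dist_nonneg)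
  have hΞ : 0 ≤ Ξ := by
    have : 0 < 1 - γ := by linarith
    have := Real.exp_pos (-(γ * PowerLaw.siteDist Λ A C))
    simp only [Ξ, PowerLaw.xi]
    positivity
  have hΦ : 0 ≤ PowerLaw.boundaryArea A := ENNReal.toReal_nonneg
  have hc₁0 : 0 ≤ c₁ := by linarith
  -- The regions may overlap: sites of B are assigned to `b`, making the three classes disjoint
  -- while A ∪ B and B ∪ C keep their sites.
  set a : Finset Λ := Finset.univ.filter fun i =>
    PowerLaw.embed (i : Fin (d + 1) → ℕ) ∈ A ∧ PowerLaw.embed (i : Fin (d + 1) → ℕ) ∉ B with ha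
  set b : Finset Λ := Finset.univ.filter fun i => PowerLaw.embed (i : Fin (d + 1) → ℕ) ∈ B with hb
  set c : Finset Λ := Finset.univ.filter fun i =>
    PowerLaw.embed (i : Fin (d + 1) → ℕ) ∈ C ∧ PowerLaw.embed (i : Fin (d + 1) → ℕ) ∉ B with hc
  have hab : Disjoint a b := by
    rw [Finset.disjoint_left]; intro i; simp +contextual [ha, hb]
  have hbc : Disjoint b c := by
    rw [Finset.disjoint_left]; intro i; simp +contextual [hb, hc]
  have hac : Disjoint a c := by
    rw [Finset.disjoint_left]
    intro i hi hi'
    exact Set.disjoint_left.1 hAC (Finset.mem_filter.1 hi).2.1 (Finset.mem_filter.1 hi').2.1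
  have hcover : ∀ i : Λ, PowerLaw.embed (i : Fin (d + 1) → ℕ) ∈ A ∪ B ∪ C := fun i =>
    hABC ▸ Set.mem_univ _
  have huniv : a ∪ b ∪ c = Finset.univ := by
    ext i
    have := hcover i
    simp only [ha, hb, hc, Finset.mem_union, Finset.mem_filter, Finset.mem_univ, true_and,
      Set.mem_union] at this ⊢
    tauto
  have hloc := PowerLaw.isLocalSystem hα' hlam hh
  have hev : ∀ {X : Set (EuclideanSpace ℝ (Fin (d + 1)))} {S : Finset Λ},
      (∀ i : Λ, PowerLaw.embed (i : Fin (d + 1) → ℕ) ∈ X ↔ i ∈ S) →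
      PowerLaw.IsEvolution (PowerLaw.interactionSum h (S ×ˢ S)) (PowerLaw.evolution h X 0) := by
    intro X S hS
    have := PowerLaw.isEvolution_interactionSum hh (S ×ˢ S)
    rwa [← PowerLaw.hamiltonian_eq_interactionSum h hS] at this ⊢
  have hU := hev (X := A ∪ B ∪ C) (S := Finset.univ) fun i => by simpa using hcover i
  rw [Finset.univ_product_univ] at hU
  have hU₁ := hev (X := A ∪ B) (S := a ∪ b) fun i => by
    simp only [ha, hb, Finset.mem_union, Finset.mem_filter, Finset.mem_univ, true_and,
      Set.mem_union]
    tauto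
  have hU₂ := hev (X := B) (S := b) fun i => by simp [hb]
  have hU₃ := hev (X := B ∪ C) (S := b ∪ c) fun i => by
    simp only [hb, hc, Finset.mem_union, Finset.mem_filter, Finset.mem_univ, true_and,
      Set.mem_union]
    tauto
  have hpaths := PowerLaw.sum_kernelIter_sites_le hAC hA
    (mul_nonneg hK.le hΦ) hc₁0 hlam1
    (hcount A hA hAconv hAi fun hd => hball (by omega)) hlam
    (PowerLaw.sum_hopLength_rpow_tail_le htail hα) hα' hγ0 hγ1 a c
    (fun i hi => (Finset.mem_filter.1 hi).2.1) (fun i hi => (Finset.mem_filter.1 hi).2.1) hΞ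
  have hzero : ∑ j ∈ c, PowerLaw.kernelIter
      (fun x z => PowerLaw.hopLength (PowerLaw.sitePos x - PowerLaw.sitePos z) ^ (-α))
      (fun x => if x ∈ a then (1 : ℝ) else 0) 0 j ≤ 0 :=
    (Finset.sum_eq_zero fun j hj => if_neg (Finset.disjoint_right.1 hac hj)).le
  have hbound : ∀ n : ℕ, ‖PowerLaw.evolution h (A ∪ B ∪ C) 0 t -
      PowerLaw.evolution h (A ∪ B) 0 t * (PowerLaw.evolution h B 0 t)ᴴ *
        PowerLaw.evolution h (B ∪ C) 0 t‖ ≤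
      K * PowerLaw.boundaryArea A * c₁ * Ξ *
        (Real.exp (4 * (lam + 1) * (2 * Real.exp 2 * lam) * t) - 1) +
      c.card * ((8 * lam * t) ^ (n + 1) / (n + 1).factorial) := by
    intro n
    refine (hloc.norm_evolution_sub_le hlam1 hab hac hbc huniv hU hU₁ hU₂ hU₃ n ht).trans ?_
    rw [Finset.sum_add_distrib, Finset.sum_const, nsmul_eq_mul]
    refine add_le_add_left (PowerLaw.sum_expPartialSum_le c (by positivity) (by positivity)
      (by positivity) hzero hpaths n ht) _
  -- The Picard remainder carries the number of sites of `c`, but for fixed Λ and t it vanishes as n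
  -- → ∞.
  have hlim : Filter.Tendsto (fun n : ℕ => K * PowerLaw.boundaryArea A * c₁ * Ξ *
      (Real.exp (4 * (lam + 1) * (2 * Real.exp 2 * lam) * t) - 1) +
      c.card * ((8 * lam * t) ^ (n + 1) / (n + 1).factorial)) Filter.atTop
      (nhds (K * PowerLaw.boundaryArea A * c₁ * Ξ *
        (Real.exp (4 * (lam + 1) * (2 * Real.exp 2 * lam) * t) - 1) + c.card * 0)) :=
    (((FloorSemiring.tendsto_pow_div_factorial_atTop (8 * lam * t)).comp
      (Filter.tendsto_add_atTop_nat 1)).const_mul _).const_add _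
  refine (ge_of_tendsto' hlim hbound).trans_eq ?_
  ring
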